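/- Let $\mathbb{K}$ be a field of characteristic zero, $S=\mathbb{K}[x_1,\dots,x_l]$, and let $\mathcal{A}$ be a central hyperplane arrangement in $\mathbb{K}^l$, i.e. a finite set of linear hyperplanes; for each $H\in\mathcal{A}$ fix a linear form $\alpha_H\in S$ with zero set $H$. Put $Q(\mathcal{A})=\prod_{H\in\mathcal{A}}\alpha_H$, and let the Jacobian ideal $J(\mathcal{A})\subseteq S$ be the ideal generated by $Q(\mathcal{A})$ and all its partial derivatives. A flat is an intersection $X$ of hyperplanes of a subset of $\mathcal{A}$; $L(\mathcal{A})_p$ denotes the set of flats of rank (i.e. codimension) $p$, $I(X)\subseteq S$ is the ideal generated by the $\alpha_H$ with $X\subseteq H\in\mathcal{A}$, and $\mathcal{A}_X=\{H\in\mathcal{A}\mid X\subseteq H\}$ is the localization at $X$. Let $D(\mathcal{A})$ be the graded $S$-module of derivations $\delta=\sum_i f_i\partial_{x_i}$, $f_i\in S$, with $\delta(\alpha_H)\in\alpha_H S$ for all $H\in\mathcal{A}$, where $\delta$ is homogeneous of degree $d$ if all $f_i$ are. The arrangement $\mathcal{A}$ is free if $D(\mathcal{A})$ is a free $S$-module,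 and it is plus-one generated if, for some integers $d_1,\dots,d_l,d\ge 0$, $D(\mathcal{A})$ has a minimal graded free resolution of the form $$0\to S(-d-1)\to S(-d)\oplus\bigoplus_{i=1}^l S(-d_i)\to D(\mathcal{A})\to 0.$$ If the $S$-module $S/J(\mathcal{A})$ has projective dimension $3$, then $$\operatorname{Ass}_S(S/J(\mathcal{A}))=\{I(X)\mid X\in L(\mathcal{A})_2\}\cup\{I(X)\mid X\in L(\mathcal{A})_3,\ \mathcal{A}_X\text{ is not free}\}.$$ Moreover, if $\mathcal{A}$ is plus-one generated, then $S/J(\mathcal{A})$ has projective dimension $3$, and hence this equality holds. -/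

import Mathlib

open MvPolynomial CategoryTheory

noncomputable section

/-- A central hyperplane arrangement in `K^l`: a finite set of linear hyperplanes, together with a
fixed defining linear form for each of them (the value of `form` outside the arrangement plays no
role). -/
structure CentralArrangement (K : Type*) [Field K] (l : ℕ) where
  /-- the finite set of hyperplanes -/
  hyperplanes : Finset (Submodule K (Fin l → K))
  /-- every member has codimension one -/
  codim_eq_one : ∀ H ∈ hyperplanes, Module.finrank K ((Fin l → K) ⧸ H) = 1
  /-- the chosen defining polynomials -/
  form : Submodule K (Fin l → K) → MvPolynomial (Fin l) K
  /-- the defining polynomials are linear homogeneous -/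
  form_isHomogeneous : ∀ H ∈ hyperplanes, (form H).IsHomogeneous 1
  /-- each hyperplane is the zero set of its defining polynomial -/
  mem_iff_eval_form : ∀ H ∈ hyperplanes, ∀ v : Fin l → K, v ∈ H ↔ eval v (form H) = 0

namespace CentralArrangement

variable {K : Type*} [Field K] {l : ℕ} (A : CentralArrangement K l)

/-- The defining polynomial `Q(A)`, the product of the defining linear forms. -/
def definingPolynomial : MvPolynomial (Fin l) K :=
  ∏ H ∈ A.hyperplanes, A.form H

/-- The Jacobian ideal `J(A)`, generated by `Q(A)` and all its partial derivatives. -/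
def jacobianIdeal : Ideal (MvPolynomial (Fin l) K) :=
  Ideal.span ({A.definingPolynomial} ∪ Set.range fun i : Fin l => pderiv i A.definingPolynomial)

/-- `X` is a flat, that is, an element of the intersection lattice `L(A)`: the intersection of
some subset of the hyperplanes (the empty intersection is the whole space). -/
def IsFlat (X : Submodule K (Fin l → K)) : Prop :=
  ∃ B ⊆ A.hyperplanes, X = B.inf id

/-- The set `L(A)_p` of flats of rank `p`, the rank of a flat being its codimension. -/
def flatsOfRank (p : ℕ) : Set (Submodule K (Fin l → K)) :=
  {X | A.IsFlat X ∧ Module.finrank K ((Fin l → K) ⧸ X) = p}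

open scoped Classical in
/-- The localization `A_X`, consisting of the hyperplanes of `A` that contain `X`. -/
def localization (X : Submodule K (Fin l → K)) : CentralArrangement K l where
  hyperplanes := A.hyperplanes.filter fun H => X ≤ H
  codim_eq_one H hH := A.codim_eq_one H (Finset.mem_filter.mp hH).1
  form := A.form
  form_isHomogeneous H hH := A.form_isHomogeneous H (Finset.mem_filter.mp hH).1
  mem_iff_eval_form H hH := A.mem_iff_eval_form H (Finset.mem_filter.mp hH).1

/-- The ideal `I(X)` of a flat `X`, generated by the linear forms of the hyperplanes containing
`X`. Any `k = codim X` of these hyperplanes with intersection `X` have forms that span all the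
others, so they generate the same ideal. -/
def flatIdeal (X : Submodule K (Fin l → K)) : Ideal (MvPolynomial (Fin l) K) :=
  Ideal.span (A.form '' {H | H ∈ A.hyperplanes ∧ X ≤ H})

/-- The module `D(A)` of logarithmic vector fields: the polynomial derivations `δ` such that
`δ(α_H)` is divisible by `α_H` for every hyperplane `H` of `A`. -/
def logDerivations :
    Submodule (MvPolynomial (Fin l) K)
      (Derivation K (MvPolynomial (Fin l) K) (MvPolynomial (Fin l) K)) where
  carrier := {δ | ∀ H ∈ A.hyperplanes, δ (A.form H) ∈ Ideal.span {A.form H}}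
  add_mem' ha hb H hH := by
    rw [Derivation.add_apply]
    exact Ideal.add_mem _ (ha H hH) (hb H hH)
  zero_mem' H _ := by
    rw [Derivation.zero_apply]
    exact Ideal.zero_mem _
  smul_mem' c δ hδ H hH := by
    rw [Derivation.smul_apply, smul_eq_mul]
    exact Ideal.mul_mem_left _ c (hδ H hH)

/-- `A` is free if `D(A)` is a free module over the polynomial ring. -/
def IsFree : Prop :=
  Module.Free (MvPolynomial (Fin l) K) A.logDerivations

end CentralArrangement

/-- A polynomial vector field `δ = ∑ fᵢ ∂/∂xᵢ` is homogeneous of polynomial degree `d` if every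
coefficient `fᵢ = δ(xᵢ)` is homogeneous of degree `d`. -/
def IsPolyHomogeneous {K : Type*} [Field K] {l : ℕ}
    (δ : Derivation K (MvPolynomial (Fin l) K) (MvPolynomial (Fin l) K)) (d : ℕ) : Prop :=
  ∀ i : Fin l, (δ (X i)).IsHomogeneous d

/-- `p` is a homogeneous element of degree `m` of the shifted module `S(-a)`: it has degree
`m - a` as a polynomial if `a ≤ m`, and it is zero if `m < a`. -/
def IsShiftedHomogeneous {K : Type*} [Field K] {l : ℕ}
    (p : MvPolynomial (Fin l) K) (a m : ℕ) : Prop :=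
  p = 0 ∨ ∃ k, m = a + k ∧ p.IsHomogeneous k

namespace CentralArrangement

variable {K : Type*} [Field K] {l : ℕ} (A : CentralArrangement K l)

/-- `A` is plus-one generated with exponents `e` and level `d`: the module `D(A)` has a minimal
graded free resolution
`0 → S(-d-1) → S(-d) ⊕ ⨁ᵢ S(-eᵢ) → D(A) → 0`
whose first map `φ` is given by `(α, f₁, …, f_l)`. Both maps preserve degrees; minimality means
that the entries of `φ` have no constant term. -/
def IsPlusOneGeneratedWith (e : Fin l → ℕ) (d : ℕ) : Prop :=
  ∃ (φ : MvPolynomial (Fin l) K →ₗ[MvPolynomial (Fin l) K]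
        MvPolynomial (Fin l) K × (Fin l → MvPolynomial (Fin l) K))
    (ψ : (MvPolynomial (Fin l) K × (Fin l → MvPolynomial (Fin l) K))
        →ₗ[MvPolynomial (Fin l) K] A.logDerivations),
    -- exactness
    Function.Injective φ ∧ Function.Exact φ ψ ∧ Function.Surjective ψ ∧
    -- the maps are homogeneous of degree zero for the shifted gradings
    IsShiftedHomogeneous (φ 1).1 d (d + 1) ∧
    (∀ i, IsShiftedHomogeneous ((φ 1).2 i) (e i) (d + 1)) ∧
    IsPolyHomogeneous (ψ (1, 0) : Derivation K (MvPolynomial (Fin l) K) _) d ∧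
    (∀ i, IsPolyHomogeneous
      (ψ (0, Pi.single i 1) : Derivation K (MvPolynomial (Fin l) K) _) (e i)) ∧
    -- minimality
    constantCoeff (φ 1).1 = 0 ∧ ∀ i, constantCoeff ((φ 1).2 i) = 0

/-- `A` is plus-one generated, for some exponents and some level. -/
def IsPlusOneGenerated : Prop :=
  ∃ (e : Fin l → ℕ) (d : ℕ), A.IsPlusOneGeneratedWith e d

end CentralArrangement

end

/-! Logarithmic vector fields are the syzygies of the generators of `J(A)`, so `S/J(A)` has
projective dimension at most `n + 2` exactly when `D(A)` has it at most `n`. A free arrangement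
gives at most 2. For a plus-one generated one the resolution bounds `pd D(A)` by 1, and minimality
forbids it to split, which gives exactly 3.

Let `P` be associated and `Y` the intersection of the hyperplanes whose forms lie in `P`. Passing to
`A_Y` changes nothing at `P`, and `J(A_Y)` is stable under derivatives along `Y`; in characteristic
zero this forces `P = I(Y)` (`eq_vanishingIdeal_of_mem_associatedPrimes`). The rank of `Y` is at
least 2 because `Q` is squarefree, and at most the projective dimension because `I(Y)` is generated
by a regular sequence of that length (`eq_zero_of_hasProjectiveDimensionLT`). Rank two flats give
minimal primes over `J(A)`.

In rank three, freeness of `A_Y` bounds the projective dimension for `A_Y` by 2, so `I(Y)` is not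
associated. Conversely, if `I(Y)` is not associated, its three linear generators form a regular
sequence on `D(A_Y)` (`isWeaklyRegular_ker`), so `D(A_Y)` is free at the prime `I(Y)`. Local
generators have determinant `Q g` with `g` not in `I(Y)`; translating by a point of `Y` where `g` is
nonzero and taking homogeneous components, Saito's criterion makes `A_Y` free. -/

/-! ### Ext vanishing, regular sequences and projective dimension. -/

section HomologicalAlgebra

universe u

variable {R : Type u} [CommRing R]

open RingTheory.Sequence Abelian

/-- `Extⁱ(N, M)` vanishes for `i` below the length of an `M`-regular sequence that kills `N`. -/
lemma ext_eq_zero_of_isWeaklyRegular (N : ModuleCat.{u} R) (rs : List R) :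
    ∀ (M : ModuleCat.{u} R), IsWeaklyRegular M rs → (∀ r ∈ rs, ∀ n : N, r • n = 0) →
      ∀ i < rs.length, ∀ e : Ext N M i, e = 0 := by
  induction rs with
  | nil => intro M _ _ i hi; simp at hi
  | cons x rs ih =>
    intro M hM hN i hi e
    rw [isWeaklyRegular_cons_iff] at hM
    have hS := hM.1.smulShortComplex_shortExact
    have hx : x • 𝟙 N = 0 := by
      ext n
      exact hN x (by simp) n
    -- Multiplication by `x` on Ext can be computed on either argument, and it is zero on `N`.
    have h0 : e.comp (Ext.mk₀ (M.smulShortComplex x).f) (add_zero i) = 0 := by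
      rw [ModuleCat.smulShortComplex_f_eq_smul_id]
      have h1 := Ext.smul_eq_comp_mk₀ (R := R) e x
      have h2 : x • e = (Ext.mk₀ (x • 𝟙 N)).comp e (zero_add i) := by
        rw [Ext.mk₀_smul, Ext.smul_comp, Ext.mk₀_id_comp]
      refine h1.symm.trans ?_
      rw [h2, hx, Ext.mk₀_zero, Ext.zero_comp]
      rfl
    cases i with
    | zero =>
      have := hS.mono_f
      apply Ext.postcomp_mk₀_injective_of_mono N (M.smulShortComplex x).f
      exact h0.trans (map_zero _).symm
    | succ n =>
      -- A class killed by `x` comes from `Ext` one degree lower with values in `M/xM`, where the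
      -- tail of the sequence is regular.
      obtain ⟨e', rfl⟩ := Ext.covariant_sequence_exact₁ N hS e h0 rfl
      rw [ih (M.smulShortComplex x).X₃ hM.2 (fun r hr => hN r (by simp [hr])) n
        (by simpa using hi) e', Ext.zero_comp]
      rfl

lemma isWeaklyRegular_of_flat {rs : List R} (h : IsWeaklyRegular R rs) (M : Type u)
    [AddCommGroup M] [Module R M] [Module.Flat R M] : IsWeaklyRegular M rs :=
  ((TensorProduct.rid R M).isWeaklyRegular_congr rs).mp h.isWeaklyRegular_lTensor

/-- If `rs` is a regular sequence on `R` killing `N`, then `Extⁱ(N, M)` vanishes for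
`i < |rs| - pd M`. -/
lemma ext_eq_zero_of_hasProjectiveDimensionLT (N : ModuleCat.{u} R) {rs : List R}
    (hrs : IsWeaklyRegular R rs) (hN : ∀ r ∈ rs, ∀ n : N, r • n = 0) (n : ℕ) :
    ∀ (M : ModuleCat.{u} R), HasProjectiveDimensionLT M (n + 1) →
      ∀ i, i + n < rs.length → ∀ e : Ext N M i, e = 0 := by
  induction n with
  | zero =>
    intro M hM i hi e
    have : Projective M := projective_iff_hasProjectiveDimensionLT_one.mpr hM
    have : Module.Projective R M := (IsProjective.iff_projective _).mpr this
    exact ext_eq_zero_of_isWeaklyRegular N rs M (isWeaklyRegular_of_flat hrs M) hN i hi e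
  | succ n ih =>
    intro M hM i hi e
    have hS := M.shortExact_projectiveShortComplex
    have h1 := (hS.hasProjectiveDimensionLT_X₃_iff n inferInstance).mp hM
    -- The boundary lies in `Ext` of the syzygy module: the degree rises by one while the projective
    -- dimension drops by one.
    have h2 : e.comp hS.extClass rfl = 0 := ih _ h1 (i + 1) (by omega) _
    obtain ⟨e', rfl⟩ := Ext.covariant_sequence_exact₃ N hS e rfl h2
    rw [ext_eq_zero_of_isWeaklyRegular N rs M.projectiveShortComplex.X₂
      (isWeaklyRegular_of_flat hrs _) hN i (by omega) e', Ext.zero_comp]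

/-- A module of projective dimension less than the length of a regular sequence has no nonzero
element killed by that sequence. -/
lemma eq_zero_of_hasProjectiveDimensionLT {rs : List R} (hrs : IsWeaklyRegular R rs)
    {M : Type u} [AddCommGroup M] [Module R M] {n : ℕ}
    (hM : HasProjectiveDimensionLT (ModuleCat.of R M) (n + 1)) (hn : n < rs.length) (m : M)
    (hm : ∀ r ∈ rs, r • m = 0) : m = 0 := by
  let f : R ⧸ Ideal.ofList rs →ₗ[R] M := Submodule.liftQ _ (LinearMap.toSpanSingleton R M m) (by
    rw [Ideal.ofList, Ideal.span, Submodule.span_le]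
    intro r hr
    simpa using hm r hr)
  have h := ext_eq_zero_of_hasProjectiveDimensionLT (ModuleCat.of R (R ⧸ Ideal.ofList rs)) hrs
    (by
      intro r hr x
      obtain ⟨x, rfl⟩ := Ideal.Quotient.mk_surjective x
      change r • (Ideal.Quotient.mk (Ideal.ofList rs) x) = 0
      rw [← Ideal.Quotient.mk_eq_mk, ← Submodule.Quotient.mk_smul, Ideal.Quotient.mk_eq_mk,
        Ideal.Quotient.eq_zero_iff_mem]
      exact Ideal.mul_mem_right _ _ (Ideal.subset_span hr)) n _ hM 0 (by omega)
    (Ext.mk₀ (ModuleCat.ofHom f))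
  have h2 : ModuleCat.ofHom f = 0 := Ext.homEquiv₀.symm.injective (h.trans (Ext.mk₀_zero _ _).symm)
  have h3 : f = 0 := by simpa using congrArg ModuleCat.Hom.hom h2
  have h4 := LinearMap.congr_fun h3 (Submodule.Quotient.mk 1)
  simpa only [f, Submodule.liftQ_apply, LinearMap.toSpanSingleton_apply, one_smul,
    LinearMap.zero_apply] using h4

/-- A finite module over a Noetherian local ring on which generators of the maximal ideal form
a regular sequence is free. -/
lemma free_of_isWeaklyRegular_of_ofList_eq_maximalIdeal (n : ℕ) :
    ∀ (R : Type u) [CommRing R] [IsNoetherianRing R] [IsLocalRing R] (M : Type u) [AddCommGroup M]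
      [Module R M] [Module.Finite R M] (rs : List R), rs.length = n →
      Ideal.ofList rs = IsLocalRing.maximalIdeal R → IsWeaklyRegular M rs → Module.Free R M := by
  induction n with
  | zero =>
    intro R _ _ _ M _ _ _ rs hl hrs _
    rw [List.length_eq_zero_iff] at hl
    subst hl
    rw [Ideal.ofList_nil] at hrs
    let _ := (IsLocalRing.isField_iff_maximalIdeal_eq.mpr hrs.symm).toField
    exact Module.Free.of_divisionRing R M
  | succ n ih =>
    intro R _ _ _ M _ _ _ rs hl hrs h
    obtain ⟨x, rs, rfl⟩ := List.exists_cons_of_length_eq_add_one hl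
    rw [isWeaklyRegular_cons_iff'] at h
    have hx : x ∈ IsLocalRing.maximalIdeal R := hrs ▸ Ideal.subset_span (by simp)
    have : Nontrivial (R ⧸ Ideal.span {x}) := Ideal.Quotient.nontrivial_iff.mpr (by
      rw [Ne, Ideal.span_singleton_eq_top]
      exact hx)
    have : IsLocalRing (R ⧸ Ideal.span {x}) :=
      IsLocalRing.of_surjective' (Ideal.Quotient.mk _) Ideal.Quotient.mk_surjective
    have : Module.FinitePresentation R M := Module.finitePresentation_of_finite R M
    have : Module.Finite (R ⧸ Ideal.span {x}) (QuotSMulTop x M) :=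
      Module.Finite.of_restrictScalars_finite R _ _
    -- For an `M`-regular `x` in the maximal ideal, freeness of `M/xM` over `R/x` lifts to `M`.
    rw [← Module.free_quotSMulTop_iff_free R M (x := x) (by
      rw [IsLocalRing.jacobson_eq_maximalIdeal _ bot_ne_top]; exact hx) h.1]
    refine ih _ _ _ (by simpa using hl) ?_ h.2
    have h1 : Ideal.ofList ((rs.map (Ideal.Quotient.mk (Ideal.span {x})))) =
        (Ideal.ofList (x :: rs)).map (Ideal.Quotient.mk (Ideal.span {x})) := by
      rw [Ideal.ofList_cons, Ideal.map_sup, Ideal.map_quotient_self, bot_sup_eq, Ideal.map_ofList]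
    rw [h1, hrs]
    refine (IsLocalRing.eq_maximalIdeal ?_)
    refine (Ideal.map_eq_top_or_isMaximal_of_surjective _ Ideal.Quotient.mk_surjective
      (IsLocalRing.maximalIdeal.isMaximal R)).resolve_left ?_
    intro htop
    have h2 := congrArg (Ideal.comap (Ideal.Quotient.mk (Ideal.span {x}))) htop
    rw [Ideal.comap_map_of_surjective _ Ideal.Quotient.mk_surjective, ← RingHom.ker_eq_comap_bot,
      Ideal.mk_ker, Ideal.comap_top, sup_eq_left.mpr (by simpa using hx)] at h2
    exact (IsLocalRing.maximalIdeal.isMaximal R).ne_top h2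

/-- The elementwise form needed for the Koszul chase in `isWeaklyRegular_ker`. -/
lemma isWeaklyRegular_triple_iff {M : Type*} [AddCommGroup M] [Module R M] (x y z : R) :
    IsWeaklyRegular M [x, y, z] ↔ (∀ m : M, x • m = 0 → m = 0) ∧
      (∀ m a : M, y • m = x • a → ∃ b, m = x • b) ∧
      (∀ m a b : M, z • m = x • a + y • b → ∃ c d, m = x • c + y • d) := by
  have h1 (m : M) : m ∈ (Ideal.ofList [x] • ⊤ : Submodule R M) ↔ ∃ a, m = x • a := by
    rw [Ideal.ofList_singleton, Submodule.ideal_span_singleton_smul,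
      Submodule.mem_smul_pointwise_iff_exists]
    simp [eq_comm]
  have h2 (m : M) : m ∈ (Ideal.ofList [x, y] • ⊤ : Submodule R M) ↔
      ∃ a b, m = x • a + y • b := by
    rw [Ideal.ofList_cons_smul, Submodule.mem_sup]
    simp only [Ideal.ofList_singleton, Submodule.ideal_span_singleton_smul,
      Submodule.mem_smul_pointwise_iff_exists]
    aesop
  rw [isWeaklyRegular_iff_Fin]
  simp only [isSMulRegular_quotient_iff_mem_of_smul_mem]
  change (∀ i : Fin 3, _) ↔ _
  simp only [Fin.forall_fin_succ]
  simp [-Ideal.ofList_cons, -Ideal.ofList_append, h1, h2]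

/-- The kernel of a linear form `π` on a free module inherits a regular sequence `x, y, z` of the
base ring, provided that no nonzero element of the cokernel is killed by `x, y, z`. -/
lemma isWeaklyRegular_ker {F : Type u} [AddCommGroup F] [Module R F] [Module.Flat R F]
    (π : F →ₗ[R] R) {x y z : R} (h : IsWeaklyRegular R [x, y, z])
    (hπ : ∀ e : R, x * e ∈ LinearMap.range π → y * e ∈ LinearMap.range π →
      z * e ∈ LinearMap.range π → e ∈ LinearMap.range π) :
    IsWeaklyRegular (LinearMap.ker π) [x, y, z] := by
  have hF := isWeaklyRegular_of_flat h F
  rw [isWeaklyRegular_triple_iff] at h hF ⊢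
  obtain ⟨h1, h2, h3⟩ := h
  obtain ⟨hF1, hF2, hF3⟩ := hF
  simp only [smul_eq_mul] at h1 h2 h3
  refine ⟨fun m hm => Subtype.ext (hF1 _ (by simpa using congrArg Subtype.val hm)), ?_, ?_⟩
  · rintro ⟨m, hm⟩ ⟨a, ha⟩ hma
    obtain ⟨b, rfl⟩ := hF2 m a (by simpa using congrArg Subtype.val hma)
    refine ⟨⟨b, ?_⟩, rfl⟩
    rw [LinearMap.mem_ker, map_smul, smul_eq_mul] at hm
    exact h1 _ hm
  · rintro ⟨m, hm⟩ ⟨d₁, hd₁⟩ ⟨d₂, hd₂⟩ hd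
    replace hd : z • m = x • d₁ + y • d₂ := by simpa using congrArg Subtype.val hd
    obtain ⟨a, b, rfl⟩ := hF3 _ _ _ hd
    -- The coefficients `a`, `b` need not lie in `ker π`. Comparing the two expressions for `z • m`
    -- yields `c`, and applying `π` to the relations shows that `(π a, π b, π c)` is a Koszul
    -- multiple `e (-y, x, -z)`.
    have e1 : y • (d₂ - z • b) = x • (z • a - d₁) := by
      rw [← sub_eq_zero] at hd ⊢
      rw [← neg_eq_zero, ← hd]
      module
    obtain ⟨c, hc⟩ := hF2 _ _ e1
    have e2 : y • c = z • a - d₁ := by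
      rw [← sub_eq_zero]
      apply hF1
      rw [hc] at e1
      rw [smul_sub, ← e1, smul_comm, sub_self]
    rw [LinearMap.mem_ker] at hm hd₁ hd₂
    have f1 : x * π a + y * π b = 0 := by simpa using hm
    have f2 : -(z * π b) = x * π c := by simpa [hd₂] using congrArg π hc
    have f3 : y * π c = z * π a := by simpa [hd₁] using congrArg π e2
    obtain ⟨e, he⟩ := h2 (π b) (-π a) (by linear_combination f1)
    have g1 : π a = -(y * e) := by
      rw [← sub_eq_zero]
      apply h1
      rw [he] at f1
      linear_combination f1
    have g2 : π c = -(z * e) := by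
      rw [← sub_eq_zero]
      apply h1
      rw [he] at f2
      linear_combination -f2
    -- Thus `x`, `y`, `z` all multiply `e` into the range of `π`, so `e = π w`; the Koszul
    -- correction by `w` moves `a`, `b` into the kernel without changing `x • a + y • b`.
    obtain ⟨w, hw⟩ := hπ e ⟨b, he⟩ ⟨-a, by simp [g1]⟩ ⟨-c, by simp [g2]⟩
    refine ⟨⟨a + y • w, by simp [g1, hw]⟩, ⟨b - x • w, by simp [he, hw]⟩, ?_⟩
    apply Subtype.ext
    simp only [Submodule.coe_add, Submodule.coe_smul]
    rw [smul_add, smul_sub, smul_comm x y w]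
    abel

/-- Dimension shifting along `0 → ker π → F → R → R ⧸ I → 0`. -/
lemma hasProjectiveDimensionLT_quotient_iff {F : Type u} [AddCommGroup F] [Module R F]
    [Module.Projective R F] (π : F →ₗ[R] R) (I : Ideal R) (hI : LinearMap.range π = I) (n : ℕ) :
    HasProjectiveDimensionLT (ModuleCat.of R (R ⧸ I)) (n + 3) ↔
      HasProjectiveDimensionLT (ModuleCat.of R (LinearMap.ker π)) (n + 1) := by
  subst hI
  have h1 := LinearMap.shortExact_shortComplexKer (f := π.rangeRestrict)
    π.surjective_rangeRestrict
  have h2 := LinearMap.shortExact_shortComplexKer (f := (LinearMap.range π).mkQ)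
    (Submodule.mkQ_surjective _)
  have e1 : LinearMap.ker π.rangeRestrict ≃ₗ[R] LinearMap.ker π :=
    LinearEquiv.ofEq _ _ (LinearMap.ker_rangeRestrict π)
  have e2 : LinearMap.ker (LinearMap.range π).mkQ ≃ₗ[R] LinearMap.range π :=
    LinearEquiv.ofEq _ _ (Submodule.ker_mkQ _)
  have p1 := h1.hasProjectiveDimensionLT_X₃_iff n
    ((IsProjective.iff_projective F).mp inferInstance)
  have p2 := h2.hasProjectiveDimensionLT_X₃_iff (n + 1)
    ((IsProjective.iff_projective R).mp inferInstance)
  have q1 : HasProjectiveDimensionLT (ModuleCat.of R (LinearMap.ker π.rangeRestrict)) (n + 1) ↔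
      HasProjectiveDimensionLT (ModuleCat.of R (LinearMap.ker π)) (n + 1) :=
    ⟨fun _ => hasProjectiveDimensionLT_of_iso e1.toModuleIso _,
      fun _ => hasProjectiveDimensionLT_of_iso e1.symm.toModuleIso _⟩
  have q2 : HasProjectiveDimensionLT (ModuleCat.of R (LinearMap.ker (LinearMap.range π).mkQ))
      (n + 2) ↔ HasProjectiveDimensionLT (ModuleCat.of R (LinearMap.range π)) (n + 2) :=
    ⟨fun _ => hasProjectiveDimensionLT_of_iso e2.toModuleIso _,
      fun _ => hasProjectiveDimensionLT_of_iso e2.symm.toModuleIso _⟩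
  exact p2.trans (q2.trans (p1.trans q1))

end HomologicalAlgebra

/-! ### Linear forms and ideals of linear subspaces. -/

section LinearForms

variable {K : Type*} [Field K] {l : ℕ}

/-- The linear form with coefficient vector `c`. -/
noncomputable def linForm (c : Fin l → K) : MvPolynomial (Fin l) K := ∑ i, C (c i) * X i

lemma isHomogeneous_linForm (c : Fin l → K) : (linForm c).IsHomogeneous 1 :=
  IsHomogeneous.sum _ _ _ fun i _ => isHomogeneous_C_mul_X (c i) i

lemma MvPolynomial.IsHomogeneous.exists_eq_linForm {f : MvPolynomial (Fin l) K}
    (hf : f.IsHomogeneous 1) : ∃ c : Fin l → K, f = linForm c := by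
  rw [← mem_homogeneousSubmodule, homogeneousSubmodule_one_eq_span_X,
    Submodule.mem_span_range_iff_exists_fun] at hf
  obtain ⟨c, rfl⟩ := hf
  exact ⟨c, by simp [linForm, smul_eq_C_mul]⟩

@[simp]
lemma eval_linForm (c v : Fin l → K) : eval v (linForm c) = ∑ i, c i * v i := by
  simp [linForm]

@[simp]
lemma pderiv_linForm (c : Fin l → K) (i : Fin l) : pderiv i (linForm c) = C (c i) := by
  simp [linForm, pderiv_X, Pi.single_apply]

/-- The coefficient vector of a linear form as a functional. -/
lemma exists_functional_eq (c : Fin l → K) :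
    ∃ φ : (Fin l → K) →ₗ[K] K, ∀ v, φ v = eval v (linForm c) :=
  ⟨Fintype.linearCombination K c, fun v => by
    simp [Fintype.linearCombination_apply, mul_comm]⟩

lemma exists_linForm_eval_eq (φ : (Fin l → K) →ₗ[K] K) :
    ∃ c : Fin l → K, ∀ v, eval v (linForm c) = φ v := by
  refine ⟨fun i => φ (Pi.single i 1), fun v => ?_⟩
  rw [eval_linForm, LinearMap.pi_apply_eq_sum_univ φ v]
  refine Finset.sum_congr rfl fun i _ => ?_
  rw [smul_eq_mul, mul_comm]
  congr 2
  ext j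
  simp [Pi.single_apply, eq_comm]

/-- Modulo the ideal, `φ` and the identity agree on the variables. When `φ g = 0` this places `g`
itself in the ideal. -/
lemma sub_algHom_mem_span (φ : MvPolynomial (Fin l) K →ₐ[K] MvPolynomial (Fin l) K)
    (g : MvPolynomial (Fin l) K) :
    g - φ g ∈ Ideal.span (Set.range fun i : Fin l => X i - φ (X i)) := by
  set I := Ideal.span (Set.range fun i : Fin l => X i - φ (X i))
  have h : (Ideal.Quotient.mkₐ K I) = (Ideal.Quotient.mkₐ K I).comp φ := by
    apply MvPolynomial.algHom_ext
    intro i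
    rw [AlgHom.comp_apply, Ideal.Quotient.mkₐ_eq_mk, Ideal.Quotient.eq]
    exact Ideal.subset_span ⟨i, rfl⟩
  have := DFunLike.congr_fun h g
  rwa [AlgHom.comp_apply, Ideal.Quotient.mkₐ_eq_mk, Ideal.Quotient.eq] at this

variable (V : Submodule K (Fin l → K))

/-- Restriction to a linear subspace `V`, followed by pullback along a projection onto `V`. -/
lemma exists_retraction_algHom :
    ∃ φ : MvPolynomial (Fin l) K →ₐ[K] MvPolynomial (Fin l) K,
      (∀ i, ∃ c, φ (X i) = linForm c) ∧ (∀ g, ∀ v ∈ V, eval v (φ g) = eval v g) ∧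
      ∀ g v, ∃ w ∈ V, eval v (φ g) = eval w g := by
  obtain ⟨p, hp⟩ := V.subtype.exists_leftInverse_of_injective V.ker_subtype
  choose c hc using fun i => exists_linForm_eval_eq ((LinearMap.proj i).comp (V.subtype.comp p))
  have key : ∀ g v, eval v (aeval (fun i => linForm (c i)) g) = eval (p v : Fin l → K) g := by
    intro g v
    rw [aeval_def, eval₂_eq_eval_map, algebraMap_eq]
    induction g using MvPolynomial.induction_on with
    | C a => simp
    | add p q hp hq => simp only [map_add, hp, hq]
    | mul_X q i hq => simp only [map_mul, hq, map_X, eval_X, hc]; rfl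
  refine ⟨aeval fun i => linForm (c i), fun i => ⟨c i, aeval_X _ i⟩, fun g v hv => ?_,
    fun g v => ⟨p v, (p v).2, key g v⟩⟩
  rw [key]
  have := DFunLike.congr_fun hp (⟨v, hv⟩ : V)
  simp only [LinearMap.comp_apply, Submodule.subtype_apply, LinearMap.id_apply] at this
  rw [this]

/-- The ideal is the kernel of a retraction into a domain; over an infinite field a polynomial
vanishing at every point is zero. -/
instance isPrime_vanishingIdeal_submodule [Infinite K] :
    (vanishingIdeal K (V : Set (Fin l → K))).IsPrime := by
  obtain ⟨φ, -, h2, h3⟩ := exists_retraction_algHom V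
  have : vanishingIdeal K (V : Set (Fin l → K)) = RingHom.ker φ := by
    ext g
    simp only [mem_vanishingIdeal_iff, RingHom.mem_ker]
    constructor
    · intro h
      refine MvPolynomial.funext fun v => ?_
      obtain ⟨w, hw, e⟩ := h3 g v
      rw [e, map_zero]
      simpa [aeval_eq_eval] using h w hw
    · intro h v hv
      simpa [h, aeval_eq_eval] using (h2 g v hv).symm
  rw [this]
  exact RingHom.ker_isPrime _

lemma mem_vanishingIdeal_submodule (g : MvPolynomial (Fin l) K) :
    g ∈ vanishingIdeal K (V : Set (Fin l → K)) ↔ ∀ v ∈ V, eval v g = 0 := by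
  simp [mem_vanishingIdeal_iff, aeval_eq_eval]

variable {V}

/-- The ideal of a linear subspace is generated by any set of linear forms cutting it out. -/
lemma span_eq_vanishingIdeal [Infinite K] {s : Set (MvPolynomial (Fin l) K)}
    (hs : ∀ f ∈ s, f.IsHomogeneous 1) (hV : ∀ v, v ∈ V ↔ ∀ f ∈ s, eval v f = 0) :
    Ideal.span s = vanishingIdeal K (V : Set (Fin l → K)) := by
  apply le_antisymm
  · rw [Ideal.span_le]
    intro f hf
    rw [SetLike.mem_coe, mem_vanishingIdeal_submodule]
    exact fun v hv => (hV v).mp hv f hf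
  -- Linear duality: a functional vanishing on the common kernel of finitely many or infinitely many
  -- functionals on `K^l` is a combination of them. `T` turns functionals back into linear forms.
  have hlin : ∀ c : Fin l → K, (∀ v ∈ V, eval v (linForm c) = 0) → linForm c ∈ Ideal.span s := by
    intro c hc
    choose c' hc' using fun f : s => (hs f f.2).exists_eq_linForm
    choose φ hφ using fun f : s => exists_functional_eq (c' f)
    obtain ⟨ψ, hψ⟩ := exists_functional_eq c
    have hmem : ψ ∈ Submodule.span K (Set.range φ) := by
      apply FiniteDimensional.mem_span_of_iInf_ker_le_ker
      intro v hv
      rw [Submodule.mem_iInf] at hv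
      rw [LinearMap.mem_ker, hψ]
      apply hc
      rw [hV]
      intro f hf
      have := hv ⟨f, hf⟩
      rwa [LinearMap.mem_ker, hφ, ← hc'] at this
    let T : ((Fin l → K) →ₗ[K] K) →ₗ[K] MvPolynomial (Fin l) K :=
      ∑ i, (LinearMap.toSpanSingleton K (MvPolynomial (Fin l) K) (X i)).comp
        (LinearMap.applyₗ (Pi.single i 1))
    have hT : ∀ (χ : (Fin l → K) →ₗ[K] K) (d : Fin l → K), (∀ v, χ v = eval v (linForm d)) →
        T χ = linForm d := by
      intro χ d h
      simp [T, linForm, h, LinearMap.sum_apply, smul_eq_C_mul, Pi.single_apply]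
    have : Submodule.span K (Set.range φ) ≤
        ((Ideal.span s).restrictScalars K).comap T := by
      rw [Submodule.span_le]
      rintro _ ⟨f, rfl⟩
      change T (φ f) ∈ Ideal.span s
      rw [hT _ _ (hφ f), ← hc']
      exact Ideal.subset_span f.2
    have := this hmem
    change T ψ ∈ Ideal.span s at this
    rwa [hT _ _ hψ] at this
  intro g hg
  rw [mem_vanishingIdeal_submodule] at hg
  obtain ⟨φ, h1, h2, h3⟩ := exists_retraction_algHom V
  have h0 : φ g = 0 := MvPolynomial.funext fun v => by
    obtain ⟨w, hw, e⟩ := h3 g v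
    rw [e, map_zero, hg w hw]
  -- Since `φ g = 0`, `g` is a combination of the linear forms `X i - φ (X i)`, which vanish on `V`.
  have hsub := sub_algHom_mem_span φ g
  rw [h0, sub_zero] at hsub
  refine (Ideal.span_le.mpr ?_) hsub
  rintro _ ⟨i, rfl⟩
  have hhom : (X i - φ (X i)).IsHomogeneous 1 := by
    obtain ⟨c, hc⟩ := h1 i
    rw [hc]
    exact (isHomogeneous_X K i).sub (isHomogeneous_linForm c)
  obtain ⟨c, hc⟩ := hhom.exists_eq_linForm
  change X i - φ (X i) ∈ Ideal.span s
  rw [hc]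
  refine hlin c fun v hv => ?_
  rw [← hc, map_sub, h2 _ v hv, sub_self]

open RingTheory.Sequence in
/-- The ideal of a linear subspace of codimension `r` is generated by a regular sequence of `r`
linear forms. -/
lemma exists_isWeaklyRegular_linear [Infinite K] (r : ℕ) :
    ∀ V : Submodule K (Fin l → K), Module.finrank K ((Fin l → K) ⧸ V) = r →
    ∃ rs : List (MvPolynomial (Fin l) K), rs.length = r ∧
      IsWeaklyRegular (MvPolynomial (Fin l) K) rs ∧ (∀ f ∈ rs, f.IsHomogeneous 1) ∧
      ∀ v, v ∈ V ↔ ∀ f ∈ rs, eval v f = 0 := by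
  induction r with
  | zero =>
    intro V hV
    have : V = ⊤ := by
      rw [← Submodule.Quotient.subsingleton_iff]
      exact Module.finrank_zero_iff.mp hV
    exact ⟨[], rfl, IsWeaklyRegular.nil _ _, by simp, by simp [this]⟩
  | succ r ih =>
    intro V hV
    have hne : V ≠ ⊤ := by
      rintro rfl
      have : Subsingleton ((Fin l → K) ⧸ (⊤ : Submodule K (Fin l → K))) :=
        Submodule.Quotient.subsingleton_iff.mpr rfl
      rw [Module.finrank_zero_of_subsingleton] at hV
      omega
    obtain ⟨w, hw⟩ : ∃ w, w ∉ V := by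
      by_contra! h
      exact hne (eq_top_iff.mpr fun x _ => h x)
    obtain ⟨φ, hφw, hφV⟩ := Submodule.exists_le_ker_of_notMem hw
    -- `V` is cut out of the larger space `W`, of codimension one less, by the single form `φ`.
    let W := V ⊔ Submodule.span K {w}
    have hVW : ∀ v, v ∈ V ↔ v ∈ W ∧ φ v = 0 := by
      intro v
      refine ⟨fun h => ⟨Submodule.mem_sup_left h, hφV h⟩, fun ⟨h, h0⟩ => ?_⟩
      obtain ⟨a, ha, b, hb, rfl⟩ := Submodule.mem_sup.mp h
      obtain ⟨t, rfl⟩ := Submodule.mem_span_singleton.mp hb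
      rw [map_add, show φ a = 0 from hφV ha, zero_add, map_smul, smul_eq_mul, mul_eq_zero] at h0
      rw [h0.resolve_right hφw, zero_smul, add_zero]
      exact ha
    have hfin : Module.finrank K ((Fin l → K) ⧸ W) = r := by
      have h1 := Submodule.finrank_quotient_add_finrank W
      have h2 := Submodule.finrank_quotient_add_finrank V
      have h3 : Module.finrank K W = Module.finrank K V + 1 := by
        have h4 := Submodule.finrank_sup_add_finrank_inf_eq V (Submodule.span K {w})
        have h5 : V ⊓ Submodule.span K {w} = ⊥ := by
          rw [eq_bot_iff]
          rintro v ⟨h6, h7⟩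
          obtain ⟨t, rfl⟩ := Submodule.mem_span_singleton.mp h7
          have h8 : φ (t • w) = 0 := hφV h6
          rw [map_smul, smul_eq_mul, mul_eq_zero] at h8
          simp [h8.resolve_right hφw]
        rw [h5, finrank_bot, finrank_span_singleton (by rintro rfl; exact hw V.zero_mem)] at h4
        exact h4
      omega
    obtain ⟨rs, hlen, hreg, hhom, hmem⟩ := ih W hfin
    obtain ⟨c, hc⟩ := exists_linForm_eval_eq φ
    refine ⟨rs ++ [linForm c], by simp [hlen], ?_, ?_, ?_⟩
    · rw [isWeaklyRegular_append_iff, isWeaklyRegular_singleton_iff,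
        isSMulRegular_quotient_iff_mem_of_smul_mem]
      refine ⟨hreg, fun x hx => ?_⟩
      have hI : Ideal.ofList rs = vanishingIdeal K (W : Set (Fin l → K)) :=
        span_eq_vanishingIdeal hhom hmem
      rw [smul_eq_mul, Ideal.mul_top, hI] at hx ⊢
      -- The new form is regular modulo the prime `I(W)` because it is nonzero at `w ∈ W`.
      refine ((isPrime_vanishingIdeal_submodule W).mem_or_mem hx).resolve_left fun h => hφw ?_
      rw [mem_vanishingIdeal_submodule] at h
      rw [← hc, h w (Submodule.mem_sup_right (Submodule.mem_span_singleton_self w))]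
    · intro f hf
      rcases List.mem_append.mp hf with hf | hf
      · exact hhom f hf
      · rw [List.mem_singleton.mp hf]
        exact isHomogeneous_linForm c
    · intro v
      rw [hVW, hmem, ← hc]
      simp [or_imp, forall_and]

end LinearForms

/-! ### Polynomial derivations in coordinates. -/

section Derivations

variable {K : Type*} [Field K] {l : ℕ}

lemma derivation_apply_eq_sum
    (δ : Derivation K (MvPolynomial (Fin l) K) (MvPolynomial (Fin l) K))
    (p : MvPolynomial (Fin l) K) : δ p = ∑ i, δ (X i) * pderiv i p := by
  induction p using MvPolynomial.induction_on with
  | C a => simp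
  | add p q hp hq => simp only [map_add, hp, hq, mul_add, Finset.sum_add_distrib]
  | mul_X p j hp =>
    simp only [Derivation.leibniz, smul_eq_mul, mul_add, Finset.sum_add_distrib, hp,
      pderiv_X, Pi.single_apply, Finset.mul_sum]
    congr 1
    · simp [mul_comm]
    · exact Finset.sum_congr rfl fun i _ => by ring

end Derivations

/-! ### Resolutions of length one. -/

section Resolutions

universe u

variable {R : Type u} [CommRing R] {F D : Type u} [AddCommGroup F] [Module R F]
  [AddCommGroup D] [Module R D] (φ : R →ₗ[R] F) (ψ : F →ₗ[R] D)

lemma hasProjectiveDimensionLT_two_of_exact [Module.Projective R F] (hφ : Function.Injective φ)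
    (hex : Function.Exact φ ψ) (hψ : Function.Surjective ψ) :
    HasProjectiveDimensionLT (ModuleCat.of R D) 2 := by
  have hS := LinearMap.shortExact_shortComplexKer (f := ψ) hψ
  refine (hS.hasProjectiveDimensionLT_X₃_iff 0
    ((IsProjective.iff_projective F).mp inferInstance)).mpr ?_
  have e1 : R ≃ₗ[R] LinearMap.ker ψ :=
    (LinearEquiv.ofInjective φ hφ).trans
      (LinearEquiv.ofEq _ _ (LinearMap.exact_iff.mp hex).symm)
  have : Module.Projective R (LinearMap.ker ψ) := Module.Projective.of_equiv e1
  exact projective_iff_hasProjectiveDimensionLT_one.mp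
    ((IsProjective.iff_projective (LinearMap.ker ψ)).mp this)

/-- Projectivity of `D` splits the sequence; the retraction will contradict minimality of the
resolution. -/
lemma exists_retraction_of_exact (hφ : Function.Injective φ) (hex : Function.Exact φ ψ)
    (hψ : Function.Surjective ψ) (hD : Module.Projective R D) :
    ∃ ρ : F →ₗ[R] R, ρ (φ 1) = 1 := by
  obtain ⟨s, hs⟩ := Module.projective_lifting_property ψ LinearMap.id hψ
  have h : (Function.Injective φ ∧ ∃ s, ψ ∘ₗ s = LinearMap.id) ↔
      (Function.Surjective ψ ∧ ∃ ρ, ρ ∘ₗ φ = LinearMap.id) := hex.split_tfae'.out 0 1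
  obtain ⟨ρ, hρ⟩ := (h.mp ⟨hφ, s, hs⟩).2
  exact ⟨ρ, DFunLike.congr_fun hρ 1⟩

lemma hasProjectiveDimensionLT_iff_of_linearEquiv (e : F ≃ₗ[R] D) (n : ℕ) :
    HasProjectiveDimensionLT (ModuleCat.of R F) n ↔
      HasProjectiveDimensionLT (ModuleCat.of R D) n :=
  ⟨fun _ => hasProjectiveDimensionLT_of_iso e.toModuleIso _,
    fun _ => hasProjectiveDimensionLT_of_iso e.symm.toModuleIso _⟩

end Resolutions

/-! ### Defining forms, logarithmic vector fields and Jacobian syzygies. -/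

namespace CentralArrangement

variable {K : Type*} [Field K] {l : ℕ} (A : CentralArrangement K l)

section Hyperplanes

variable {A} {H H' : Submodule K (Fin l → K)}

lemma hyperplane_ne_top (hH : H ∈ A.hyperplanes) : H ≠ ⊤ := by
  rintro rfl
  have h := A.codim_eq_one _ hH
  have : Subsingleton ((Fin l → K) ⧸ (⊤ : Submodule K (Fin l → K))) :=
    Submodule.Quotient.subsingleton_iff.mpr rfl
  rw [Module.finrank_zero_of_subsingleton] at h
  exact zero_ne_one h

lemma hyperplane_eq_of_le (hH : H ∈ A.hyperplanes) (hH' : H' ∈ A.hyperplanes) (h : H ≤ H') :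
    H = H' := by
  apply Submodule.eq_of_le_of_finrank_eq h
  have h1 := Submodule.finrank_quotient_add_finrank H
  have h2 := Submodule.finrank_quotient_add_finrank H'
  rw [A.codim_eq_one _ hH] at h1
  rw [A.codim_eq_one _ hH'] at h2
  omega

lemma exists_form_eq (hH : H ∈ A.hyperplanes) :
    ∃ c : Fin l → K, c ≠ 0 ∧ A.form H = linForm c := by
  obtain ⟨c, hc⟩ := (A.form_isHomogeneous H hH).exists_eq_linForm
  refine ⟨c, ?_, hc⟩
  rintro rfl
  refine hyperplane_ne_top hH (eq_top_iff.mpr fun v _ => ?_)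
  rw [A.mem_iff_eval_form H hH, hc]
  simp

lemma form_ne_zero (hH : H ∈ A.hyperplanes) : A.form H ≠ 0 := by
  intro h
  refine hyperplane_ne_top hH (eq_top_iff.mpr fun v _ => ?_)
  rw [A.mem_iff_eval_form H hH, h, map_zero]

variable [Infinite K]

lemma span_form_eq (hH : H ∈ A.hyperplanes) :
    Ideal.span {A.form H} = vanishingIdeal K (H : Set (Fin l → K)) :=
  span_eq_vanishingIdeal (by simpa using A.form_isHomogeneous H hH)
    (by simpa using A.mem_iff_eval_form H hH)

lemma prime_form (hH : H ∈ A.hyperplanes) : Prime (A.form H) := by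
  rw [← Ideal.span_singleton_prime (form_ne_zero hH), span_form_eq hH]
  infer_instance

lemma form_dvd_form (hH : H ∈ A.hyperplanes) (hH' : H' ∈ A.hyperplanes)
    (h : A.form H ∣ A.form H') : H = H' := by
  apply hyperplane_eq_of_le hH hH'
  rw [← Ideal.mem_span_singleton, span_form_eq hH, mem_vanishingIdeal_submodule] at h
  exact fun v hv => (A.mem_iff_eval_form H' hH' v).mpr (h v hv)

lemma not_form_dvd_prod (hH : H ∈ A.hyperplanes) {B : Finset (Submodule K (Fin l → K))}
    (hB : B ⊆ A.hyperplanes) (hHB : H ∉ B) : ¬ A.form H ∣ ∏ H' ∈ B, A.form H' := by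
  rw [(prime_form hH).dvd_finsetProd_iff]
  rintro ⟨H', hH', h⟩
  exact hHB (form_dvd_form hH (hB hH') h ▸ hH')

lemma definingPolynomial_dvd {p : MvPolynomial (Fin l) K}
    (h : ∀ H ∈ A.hyperplanes, A.form H ∣ p) : A.definingPolynomial ∣ p := by
  refine Finset.prod_dvd_of_isRelPrime ?_ h
  intro H hH H' hH' hne
  rw [Function.onFun, (prime_form hH).irreducible.isRelPrime_iff_not_dvd]
  exact fun h => hne (form_dvd_form hH hH' h)

end Hyperplanes

lemma definingPolynomial_ne_zero : A.definingPolynomial ≠ 0 :=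
  Finset.prod_ne_zero_iff.mpr fun _ hH => form_ne_zero hH

lemma isHomogeneous_definingPolynomial :
    A.definingPolynomial.IsHomogeneous A.hyperplanes.card := by
  have h := IsHomogeneous.prod A.hyperplanes A.form (fun _ => 1) A.form_isHomogeneous
  rwa [Finset.sum_const, smul_eq_mul, mul_one] at h

open scoped Classical in
lemma form_mul_prod_erase {H : Submodule K (Fin l → K)} (hH : H ∈ A.hyperplanes) :
    A.form H * ∏ H' ∈ A.hyperplanes.erase H, A.form H' = A.definingPolynomial :=
  Finset.mul_prod_erase _ _ hH

/-- By Leibniz, `δ Q` is `(Q/α_H) δ(α_H)` modulo `α_H`, and the prime `α_H` does not divide `Q/α_H`.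
-/
lemma mem_logDerivations_iff [Infinite K]
    {δ : Derivation K (MvPolynomial (Fin l) K) (MvPolynomial (Fin l) K)} :
    δ ∈ A.logDerivations ↔ A.definingPolynomial ∣ δ A.definingPolynomial := by
  classical
  constructor
  · intro h
    refine definingPolynomial_dvd fun H hH => ?_
    rw [← A.form_mul_prod_erase hH, Derivation.leibniz]
    exact dvd_add (Dvd.intro _ rfl)
      (Dvd.dvd.mul_left (Ideal.mem_span_singleton.mp (h H hH)) _)
  · intro h H hH
    have h1 : A.form H ∣ δ A.definingPolynomial :=
      (Finset.dvd_prod_of_mem A.form hH).trans h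
    rw [← A.form_mul_prod_erase hH, Derivation.leibniz, smul_eq_mul, smul_eq_mul,
      dvd_add_right (Dvd.intro _ rfl)] at h1
    exact Ideal.mem_span_singleton.mpr (((prime_form hH).dvd_or_dvd h1).resolve_left
      (not_form_dvd_prod hH (Finset.erase_subset _ _) (Finset.notMem_erase _ _)))

/-- The map `(f, g) ↦ ∑ fᵢ ∂ᵢQ + g Q`, whose image is the Jacobian ideal. -/
noncomputable def jacobianMap :
    ((Fin l → MvPolynomial (Fin l) K) × MvPolynomial (Fin l) K) →ₗ[MvPolynomial (Fin l) K]
      MvPolynomial (Fin l) K :=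
  (Fintype.linearCombination (MvPolynomial (Fin l) K)
    fun i => pderiv i A.definingPolynomial).coprod
    (LinearMap.toSpanSingleton _ _ A.definingPolynomial)

lemma jacobianMap_apply (f : Fin l → MvPolynomial (Fin l) K) (g : MvPolynomial (Fin l) K) :
    A.jacobianMap (f, g) =
      mkDerivation K f A.definingPolynomial + g * A.definingPolynomial := by
  rw [derivation_apply_eq_sum (mkDerivation K f)]
  simp [jacobianMap, Fintype.linearCombination_apply, mkDerivation_X]

lemma range_jacobianMap : LinearMap.range A.jacobianMap = A.jacobianIdeal := by
  rw [jacobianMap, LinearMap.range_coprod, Fintype.range_linearCombination,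
    LinearMap.range_toSpanSingleton, jacobianIdeal, Ideal.span_union, sup_comm]

/-- A polynomial vector field corresponds to its coefficient vector. -/
noncomputable def derivationCoeffs :
    Derivation K (MvPolynomial (Fin l) K) (MvPolynomial (Fin l) K) ≃ₗ[MvPolynomial (Fin l) K]
      (Fin l → MvPolynomial (Fin l) K) where
  toFun δ i := δ (X i)
  map_add' _ _ := rfl
  map_smul' _ _ := rfl
  invFun f := mkDerivation K f
  left_inv _ := MvPolynomial.derivation_ext fun i => mkDerivation_X K _ i
  right_inv f := funext fun i => mkDerivation_X K f i

@[simp]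
lemma derivationCoeffs_apply (δ : Derivation K (MvPolynomial (Fin l) K) (MvPolynomial (Fin l) K))
    (i : Fin l) : derivationCoeffs δ i = δ (X i) := rfl

lemma mkDerivation_derivationCoeffs
    (δ : Derivation K (MvPolynomial (Fin l) K) (MvPolynomial (Fin l) K)) :
    mkDerivation K (derivationCoeffs δ) = δ :=
  derivationCoeffs.symm_apply_apply δ

lemma mkDerivation_definingPolynomial_of_mem_ker
    (x : (Fin l → MvPolynomial (Fin l) K) × MvPolynomial (Fin l) K)
    (hx : x ∈ LinearMap.ker A.jacobianMap) :
    mkDerivation K x.1 A.definingPolynomial = A.definingPolynomial * -x.2 := by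
  obtain ⟨f, g⟩ := x
  rw [LinearMap.mem_ker, jacobianMap_apply] at hx
  linear_combination hx

/-- The vector field of a syzygy of the generators of the Jacobian ideal. -/
noncomputable def logDerivationOfSyzygy [Infinite K] :
    LinearMap.ker A.jacobianMap →ₗ[MvPolynomial (Fin l) K] A.logDerivations :=
  LinearMap.codRestrict A.logDerivations
    (derivationCoeffs.symm.toLinearMap ∘ₗ LinearMap.fst _ _ _ ∘ₗ
      (LinearMap.ker A.jacobianMap).subtype)
    fun x => A.mem_logDerivations_iff.mpr
      ⟨-x.1.2, A.mkDerivation_definingPolynomial_of_mem_ker x.1 x.2⟩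

/-- The coefficient of `Q` in a syzygy is determined by the vector field, by cancelling `Q`. -/
lemma logDerivationOfSyzygy_bijective [Infinite K] :
    Function.Bijective A.logDerivationOfSyzygy := by
  constructor
  · rintro ⟨x, hx⟩ ⟨y, hy⟩ hxy
    have h : mkDerivation K x.1 = mkDerivation K y.1 := congrArg Subtype.val hxy
    refine Subtype.ext (Prod.ext (derivationCoeffs.symm.injective h) ?_)
    have h1 := A.mkDerivation_definingPolynomial_of_mem_ker x hx
    rw [h, A.mkDerivation_definingPolynomial_of_mem_ker y hy] at h1
    exact (neg_injective (mul_left_cancel₀ A.definingPolynomial_ne_zero h1)).symm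
  · rintro ⟨δ, hδ⟩
    obtain ⟨g, hg⟩ := A.mem_logDerivations_iff.mp hδ
    refine ⟨⟨(derivationCoeffs δ, -g), ?_⟩, Subtype.ext (mkDerivation_derivationCoeffs δ)⟩
    rw [LinearMap.mem_ker, jacobianMap_apply, mkDerivation_derivationCoeffs]
    linear_combination hg

/-- Logarithmic vector fields are the syzygies of the generators of the Jacobian ideal. -/
noncomputable def logDerivationsEquivKer [Infinite K] :
    LinearMap.ker A.jacobianMap ≃ₗ[MvPolynomial (Fin l) K] A.logDerivations :=
  LinearEquiv.ofBijective A.logDerivationOfSyzygy A.logDerivationOfSyzygy_bijective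

/-- Projective dimensions of `S/J(A)` and of `D(A)` differ by two. -/
lemma hasProjectiveDimensionLT_quotient_jacobianIdeal_iff [Infinite K] (n : ℕ) :
    HasProjectiveDimensionLT (ModuleCat.of (MvPolynomial (Fin l) K)
        (MvPolynomial (Fin l) K ⧸ A.jacobianIdeal)) (n + 3) ↔
      HasProjectiveDimensionLT (ModuleCat.of (MvPolynomial (Fin l) K) A.logDerivations)
        (n + 1) := by
  rw [hasProjectiveDimensionLT_quotient_iff A.jacobianMap _ A.range_jacobianMap n]
  exact hasProjectiveDimensionLT_iff_of_linearEquiv (R := MvPolynomial (Fin l) K)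
    (F := LinearMap.ker A.jacobianMap) (D := A.logDerivations) A.logDerivationsEquivKer _

lemma IsFree.hasProjectiveDimensionLT [Infinite K] {A : CentralArrangement K l} (h : A.IsFree) :
    HasProjectiveDimensionLT (ModuleCat.of (MvPolynomial (Fin l) K)
        (MvPolynomial (Fin l) K ⧸ A.jacobianIdeal)) 3 := by
  rw [A.hasProjectiveDimensionLT_quotient_jacobianIdeal_iff 0,
    ← projective_iff_hasProjectiveDimensionLT_one, ← IsProjective.iff_projective]
  have : Module.Free _ A.logDerivations := h
  infer_instance

/-- The Jacobian algebra of a plus-one generated arrangement has projective dimension three. -/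
lemma IsPlusOneGenerated.projectiveDimension_eq [Infinite K] {A : CentralArrangement K l}
    (h : A.IsPlusOneGenerated) :
    projectiveDimension (ModuleCat.of (MvPolynomial (Fin l) K)
        (MvPolynomial (Fin l) K ⧸ A.jacobianIdeal)) = 3 := by
  obtain ⟨e, d, φ, ψ, hφ, hex, hψ, -, -, -, -, h1, h2⟩ := h
  have key : projectiveDimension (ModuleCat.of (MvPolynomial (Fin l) K)
        (MvPolynomial (Fin l) K ⧸ A.jacobianIdeal)) = ((3 : ℕ) : WithBot ℕ∞) := by
    apply le_antisymm
    · rw [projectiveDimension_le_iff]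
      refine (A.hasProjectiveDimensionLT_quotient_jacobianIdeal_iff 1).mpr ?_
      exact hasProjectiveDimensionLT_two_of_exact (R := MvPolynomial (Fin l) K)
        (F := MvPolynomial (Fin l) K × (Fin l → MvPolynomial (Fin l) K)) (D := A.logDerivations)
        φ ψ hφ hex hψ
    · rw [projectiveDimension_ge_iff, A.hasProjectiveDimensionLT_quotient_jacobianIdeal_iff 0,
        ← projective_iff_hasProjectiveDimensionLT_one, ← IsProjective.iff_projective]
      intro hproj
      obtain ⟨ρ, h3⟩ := exists_retraction_of_exact (R := MvPolynomial (Fin l) K)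
        (F := MvPolynomial (Fin l) K × (Fin l → MvPolynomial (Fin l) K)) (D := A.logDerivations)
        φ ψ hφ hex hψ hproj
      -- By minimality every coordinate of `φ 1` has zero constant term, hence so does `ρ (φ 1)`,
      -- which should be 1.
      have h4 : φ 1 = (φ 1).1 • (1, 0) + ∑ i, (φ 1).2 i • (0, Pi.single i 1) := by
        refine Prod.ext ?_ ?_
        · simp [Prod.fst_sum]
        · ext1 j
          simp [Prod.snd_sum, Pi.single_apply]
      have h5 := congrArg constantCoeff h3
      rw [h4] at h5
      simp only [map_add, map_smul, map_sum, smul_eq_mul, map_mul, h1, h2, zero_mul,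
        Finset.sum_const_zero, add_zero, map_one, zero_ne_one] at h5
  exact key

end CentralArrangement

/-! ### Associated primes of quotient rings. -/

section AssociatedPrimes

variable {R : Type*} [CommRing R] [IsNoetherianRing R]

lemma mem_associatedPrimes_quotient_iff (I P : Ideal R) :
    P ∈ associatedPrimes R (R ⧸ I) ↔ P.IsPrime ∧ ∃ f, ∀ a, a ∈ P ↔ a * f ∈ I := by
  rw [AssociatedPrimes.mem_iff, isAssociatedPrime_iff]
  refine and_congr_right fun _ => ?_
  have key : ∀ f a : R, a ∈ (⊥ : Submodule R (R ⧸ I)).colon {Ideal.Quotient.mk I f} ↔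
      a * f ∈ I := by
    intro f a
    rw [Submodule.mem_colon_singleton, Submodule.mem_bot, ← Ideal.Quotient.eq_zero_iff_mem]
    rfl
  constructor
  · rintro ⟨x, rfl⟩
    obtain ⟨f, rfl⟩ := Ideal.Quotient.mk_surjective x
    exact ⟨f, key f⟩
  · rintro ⟨f, hf⟩
    exact ⟨Ideal.Quotient.mk I f, Ideal.ext fun a => (hf a).trans (key f a).symm⟩

/-- Associated primes of `R ⧸ I` and `R ⧸ J` away from an element `s` with `s J ⊆ I ⊆ J`. -/
lemma mem_associatedPrimes_quotient_iff_of_mul_mem {I J P : Ideal R} (hIJ : I ≤ J) {s : R}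
    (hs : s ∉ P) (hsJ : ∀ x ∈ J, s * x ∈ I) :
    P ∈ associatedPrimes R (R ⧸ I) ↔ P ∈ associatedPrimes R (R ⧸ J) := by
  rw [mem_associatedPrimes_quotient_iff, mem_associatedPrimes_quotient_iff]
  refine and_congr_right fun hP => ⟨?_, ?_⟩
  · rintro ⟨f, hf⟩
    refine ⟨f, fun a => ⟨fun ha => hIJ ((hf a).mp ha), fun ha => ?_⟩⟩
    have h1 : s * a ∈ P := (hf _).mpr (by simpa [mul_assoc] using hsJ _ ha)
    exact (hP.mem_or_mem h1).resolve_left hs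
  · rintro ⟨f, hf⟩
    -- The factor `s` turns membership in `J` into membership in `I`, and is cancelled modulo the
    -- prime `P`.
    refine ⟨s * f, fun a => ⟨fun ha => ?_, fun ha => ?_⟩⟩
    · simpa [mul_left_comm] using hsJ _ ((hf a).mp ha)
    · have h1 : a * s ∈ P := (hf _).mpr (hIJ (by simpa [mul_assoc] using ha))
      exact (hP.mem_or_mem h1).resolve_right hs

/-- An element of `R ⧸ I` whose annihilator contains `P` gives an associated prime over `P`. -/
lemma exists_le_mem_associatedPrimes_quotient {I P : Ideal R} {e : R} (he : e ∉ I)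
    (hP : ∀ a ∈ P, a * e ∈ I) : ∃ P' ∈ associatedPrimes R (R ⧸ I), P ≤ P' := by
  obtain ⟨P', h1, h2⟩ := exists_le_isAssociatedPrime_of_isNoetherianRing R
    (Ideal.Quotient.mk I e) (by rwa [Ne, Ideal.Quotient.eq_zero_iff_mem])
  refine ⟨P', h1, le_trans (fun a ha => ?_) h2⟩
  rw [Submodule.mem_colon_singleton, Submodule.mem_bot]
  exact Ideal.Quotient.eq_zero_iff_mem.mpr (hP a ha)

end AssociatedPrimes

/-! ### Ideals stable under derivatives along a subspace. -/

section DirectionalDerivatives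

variable {K : Type*} [Field K] {l : ℕ}

/-- The derivative in the direction of the vector `v`. -/
noncomputable def dirDeriv (v : Fin l → K) :
    Derivation K (MvPolynomial (Fin l) K) (MvPolynomial (Fin l) K) :=
  mkDerivation K fun i => C (v i)

lemma dirDeriv_eq_sum (v : Fin l → K) (p : MvPolynomial (Fin l) K) :
    dirDeriv v p = ∑ i, C (v i) * pderiv i p := by
  rw [derivation_apply_eq_sum]
  simp [dirDeriv, mkDerivation_X]

lemma dirDeriv_linForm (v c : Fin l → K) :
    dirDeriv v (linForm c) = C (eval v (linForm c)) := by
  simp [dirDeriv_eq_sum, mul_comm]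

/-- Both derivations have constant coefficients, so their commutator kills the variables. -/
lemma dirDeriv_pderiv (v : Fin l → K) (i : Fin l) (p : MvPolynomial (Fin l) K) :
    dirDeriv v (pderiv i p) = pderiv i (dirDeriv v p) := by
  have h : ⁅dirDeriv v, (pderiv i :
      Derivation K (MvPolynomial (Fin l) K) (MvPolynomial (Fin l) K))⁆ = 0 := by
    apply MvPolynomial.derivation_ext
    intro j
    rw [Derivation.commutator_apply, pderiv_X, dirDeriv, mkDerivation_X, pderiv_C]
    rcases eq_or_ne j i with rfl | hj <;> simp [*]
  have := DFunLike.congr_fun h p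
  rwa [Derivation.commutator_apply, Derivation.zero_apply, sub_eq_zero] at this

lemma totalDegree_dirDeriv_le (v : Fin l → K) {p : MvPolynomial (Fin l) K} {n : ℕ}
    (hp : p.totalDegree ≤ n + 1) : (dirDeriv v p).totalDegree ≤ n := by
  have key : ∀ i, (pderiv i p).totalDegree ≤ n := by
    intro i
    rw [p.as_sum, map_sum]
    refine totalDegree_finsetSum_le fun m hm => ?_
    rw [pderiv_monomial]
    rcases Nat.eq_zero_or_pos (m i) with h0 | h0
    · simp [h0]
    · refine (totalDegree_monomial_le _ _).trans ?_
      have h1 : (m.sum fun _ => id) ≤ n + 1 := (le_totalDegree hm).trans hp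
      have h2 : Finsupp.single i 1 ≤ m := by simpa using Nat.succ_le_of_lt h0
      have h3 : (m - Finsupp.single i 1).degree + 1 = m.degree := by
        conv_rhs => rw [← tsub_add_cancel_of_le h2, map_add, Finsupp.degree_single]
      have h4 : m.degree ≤ n + 1 := h1
      have h5 : (m - Finsupp.single i 1).degree ≤ n := by omega
      exact h5
  rw [dirDeriv_eq_sum]
  refine totalDegree_finsetSum_le fun i _ => (totalDegree_mul _ _).trans ?_
  rw [totalDegree_C, zero_add]
  exact key i

/-- The chain rule on the line `t ↦ t v`, reducing constancy on a subspace to one variable. -/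
lemma derivative_aeval_line (v : Fin l → K) (p : MvPolynomial (Fin l) K) :
    Polynomial.derivative (aeval (fun i => Polynomial.C (v i) * Polynomial.X) p) =
      aeval (fun i => Polynomial.C (v i) * Polynomial.X) (dirDeriv v p) := by
  induction p using MvPolynomial.induction_on with
  | C a => simp [Polynomial.algebraMap_eq]
  | add p q hp hq => simp only [map_add, hp, hq]
  | mul_X p i hp =>
    have h : dirDeriv v (X i) = C (v i) := mkDerivation_X K _ i
    rw [Derivation.leibniz, h, map_add, smul_eq_mul, smul_eq_mul, map_mul (aeval _),
      map_mul (aeval _), map_mul (aeval _), Polynomial.derivative_mul, hp, aeval_X, algHom_C,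
      Polynomial.algebraMap_eq, Polynomial.derivative_C_mul, Polynomial.derivative_X, mul_one]
    ring

lemma eval_aeval_line (v : Fin l → K) (p : MvPolynomial (Fin l) K) (t : K) :
    Polynomial.eval t (aeval (fun i => Polynomial.C (v i) * Polynomial.X) p) =
      eval (t • v) p := by
  induction p using MvPolynomial.induction_on with
  | C a => simp [Polynomial.algebraMap_eq]
  | add p q hp hq => simp only [map_add, Polynomial.eval_add, hp, hq]
  | mul_X p i hp =>
    rw [map_mul, map_mul, Polynomial.eval_mul, hp, aeval_X, eval_X, Polynomial.eval_C_mul,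
      Polynomial.eval_X, Pi.smul_apply, smul_eq_mul, mul_comm t]

variable [CharZero K] (V : Submodule K (Fin l → K))

/-- A polynomial whose derivatives along `V` vanish on `V` is constant on `V`. -/
lemma sub_constantCoeff_mem_vanishingIdeal {g : MvPolynomial (Fin l) K}
    (hg : ∀ v ∈ V, dirDeriv v g ∈ vanishingIdeal K (V : Set (Fin l → K))) :
    g - C (eval 0 g) ∈ vanishingIdeal K (V : Set (Fin l → K)) := by
  rw [mem_vanishingIdeal_submodule]
  intro v hv
  have h1 : Polynomial.derivative
      (aeval (fun i => Polynomial.C (v i) * Polynomial.X) g : Polynomial K) = 0 := by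
    rw [derivative_aeval_line]
    refine Polynomial.funext fun t => ?_
    rw [eval_aeval_line, Polynomial.eval_zero]
    exact (mem_vanishingIdeal_submodule V _).mp (hg v hv) _ (V.smul_mem t hv)
  -- Characteristic zero enters here: the restriction to the line is constant, so its values at `t =
  -- 1` and `t = 0` agree.
  have h2 := Polynomial.eq_C_of_derivative_eq_zero h1
  have h3 := eval_aeval_line v g 1
  have h4 := eval_aeval_line v g 0
  rw [h2, Polynomial.eval_C] at h3 h4
  rw [one_smul] at h3
  rw [zero_smul] at h4
  rw [map_sub, eval_C, ← h3, ← h4, sub_self]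

/-- A proper ideal containing the ideal of `V` that is stable under the derivatives along `V`
is the ideal of `V`. -/
lemma eq_top_of_dirDeriv_mem {𝔞 : Ideal (MvPolynomial (Fin l) K)}
    (hV : vanishingIdeal K (V : Set (Fin l → K)) ≤ 𝔞)
    (h𝔞 : ∀ v ∈ V, ∀ g ∈ 𝔞, dirDeriv v g ∈ 𝔞) (n : ℕ) :
    ∀ g ∈ 𝔞, g.totalDegree ≤ n → g ∉ vanishingIdeal K (V : Set (Fin l → K)) → 𝔞 = ⊤ := by
  -- Here `g` is a nonzero constant modulo the ideal of `V`, so `𝔞` contains a unit. Differentiation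
  -- lowers the degree until this case occurs.
  have key : ∀ g ∈ 𝔞, g ∉ vanishingIdeal K (V : Set (Fin l → K)) →
      (∀ v ∈ V, dirDeriv v g ∈ vanishingIdeal K (V : Set (Fin l → K))) → 𝔞 = ⊤ := by
    intro g hg hgV hd
    have h1 := sub_constantCoeff_mem_vanishingIdeal V hd
    have h2 : C (eval 0 g) ∈ 𝔞 := by
      have := 𝔞.sub_mem hg (hV h1)
      rwa [sub_sub_cancel] at this
    refine Ideal.eq_top_of_isUnit_mem _ h2 (IsUnit.map C (isUnit_iff_ne_zero.mpr fun h0 => ?_))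
    rw [h0, map_zero, sub_zero] at h1
    exact hgV h1
  induction n with
  | zero =>
    intro g hg hn hgV
    refine key g hg hgV fun v hv => ?_
    rw [totalDegree_eq_zero_iff_eq_C.mp (Nat.le_zero.mp hn), derivation_C]
    exact Ideal.zero_mem _
  | succ n ih =>
    intro g hg hn hgV
    by_cases hd : ∀ v ∈ V, dirDeriv v g ∈ vanishingIdeal K (V : Set (Fin l → K))
    · exact key g hg hgV hd
    · push Not at hd
      obtain ⟨v, hv, hd⟩ := hd
      exact ih _ (h𝔞 v hv g hg) (totalDegree_dirDeriv_le v hn) hd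

/-- If `J` is stable under the derivatives along `V`, then the only associated prime of `S ⧸ J`
containing the ideal of `V` can be the ideal of `V` itself. -/
lemma eq_vanishingIdeal_of_mem_associatedPrimes {J P : Ideal (MvPolynomial (Fin l) K)}
    (hJ : ∀ v ∈ V, ∀ g ∈ J, dirDeriv v g ∈ J)
    (hP : P ∈ associatedPrimes _ (MvPolynomial (Fin l) K ⧸ J))
    (hVP : vanishingIdeal K (V : Set (Fin l → K)) ≤ P) :
    P = vanishingIdeal K (V : Set (Fin l → K)) := by
  set I := vanishingIdeal K (V : Set (Fin l → K))
  have hIp : I.IsPrime := isPrime_vanishingIdeal_submodule V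
  -- `I` is generated by linear forms `a` vanishing on `V`, and for these `a * dirDeriv v f =
  -- dirDeriv v (a * f)`.
  have hId : ∀ v ∈ V, ∀ f, (∀ a ∈ I, a * f ∈ J) → ∀ a ∈ I, a * dirDeriv v f ∈ J := by
    obtain ⟨rs, -, -, hhom, hmem⟩ := exists_isWeaklyRegular_linear _ V rfl
    have hspan : Ideal.span {f | f ∈ rs} = I := span_eq_vanishingIdeal hhom hmem
    intro v hv f hf
    have hle : I ≤ J.colon {dirDeriv v f} := by
      rw [← hspan, Ideal.span_le]
      intro a ha
      have h1 := hJ v hv _ (hf a (hspan ▸ Ideal.subset_span ha))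
      obtain ⟨c, rfl⟩ := (hhom a ha).exists_eq_linForm
      rw [Derivation.leibniz, dirDeriv_linForm, (hmem v).mp hv _ ha, map_zero,
        smul_zero, add_zero] at h1
      exact Submodule.mem_colon_singleton.mpr h1
    exact fun a ha => Submodule.mem_colon_singleton.mp (hle ha)
  -- Modulo `J`, `T` collects the elements killed by `I` and also by something outside `I`. The aim
  -- is that `T` is zero modulo `J`.
  let T : Ideal (MvPolynomial (Fin l) K) :=
    { carrier := {f | (∀ a ∈ I, a * f ∈ J) ∧ ∃ g ∉ I, g * f ∈ J}
      add_mem' := by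
        rintro f f' ⟨h1, g, hg, h2⟩ ⟨h1', g', hg', h2'⟩
        refine ⟨fun a ha => by rw [mul_add]; exact J.add_mem (h1 a ha) (h1' a ha), g * g',
          fun h => (hIp.mem_or_mem h).elim hg hg', ?_⟩
        have := J.add_mem (J.mul_mem_left g' h2) (J.mul_mem_left g h2')
        convert this using 1
        ring
      zero_mem' := ⟨by simp, 1, fun h => hIp.ne_top ((Ideal.eq_top_iff_one _).mpr h), by simp⟩
      smul_mem' := by
        rintro p f ⟨h1, g, hg, h2⟩
        refine ⟨fun a ha => ?_, g, hg, ?_⟩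
        · rw [smul_eq_mul, mul_left_comm]
          exact J.mul_mem_left _ (h1 a ha)
        · rw [smul_eq_mul, mul_left_comm]
          exact J.mul_mem_left _ h2 }
  have hTd : ∀ v ∈ V, ∀ f ∈ T, dirDeriv v f ∈ T := by
    rintro v hv f ⟨h1, g, hg, h2⟩
    -- From `g f ∈ J`: `g² ∂f = g ∂(g f) - (∂g) g f`.
    refine ⟨hId v hv f h1, g * g, fun h => hg (by simpa using hIp.mem_or_mem h), ?_⟩
    have h3 := hJ v hv _ h2
    rw [Derivation.leibniz, smul_eq_mul, smul_eq_mul] at h3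
    have := J.sub_mem (J.mul_mem_left g h3) (J.mul_mem_left (dirDeriv v g) h2)
    convert this using 1
    ring
  -- `T` is finitely generated and `I` is prime, so a product of the multipliers works for all of
  -- `T`.
  obtain ⟨g, hgI, hgT⟩ : ∃ g ∉ I, ∀ f ∈ T, g * f ∈ J := by
    obtain ⟨t, ht⟩ := IsNoetherian.noetherian T
    have hx : ∀ x, ∃ g, g ∉ I ∧ (x ∈ T → g * x ∈ J) := by
      intro x
      by_cases hx : x ∈ T
      · obtain ⟨-, g, hg, h⟩ := hx
        exact ⟨g, hg, fun _ => h⟩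
      · exact ⟨1, fun h => hIp.ne_top ((Ideal.eq_top_iff_one _).mpr h), fun h => (hx h).elim⟩
    choose g hg hgx using hx
    refine ⟨∏ x ∈ t, g x, fun h => ?_, ?_⟩
    · obtain ⟨x, -, hx⟩ := hIp.prod_mem_iff.mp h
      exact hg x hx
    · have hle : T ≤ J.colon {∏ x ∈ t, g x} := by
        rw [← ht]
        refine Submodule.span_le.mpr fun x hx => Submodule.mem_colon_singleton.mpr ?_
        obtain ⟨q, hq⟩ := Finset.dvd_prod_of_mem g hx
        have := J.mul_mem_left q (hgx x (ht ▸ Submodule.subset_span hx))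
        rw [hq, smul_eq_mul]
        convert this using 1
        ring
      intro f hf
      rw [mul_comm]
      exact Submodule.mem_colon_singleton.mp (hle hf)
  -- The ideal `J : T` contains `I`, is stable under derivatives along `V`, and contains `g ∉ I`.
  have htop : J.colon (T : Set (MvPolynomial (Fin l) K)) = ⊤ := by
    refine eq_top_of_dirDeriv_mem V (fun a ha => ?_) (fun v hv a ha => ?_) _ g ?_ le_rfl hgI
    · exact Submodule.mem_colon.mpr fun f hf => hf.1 a ha
    · rw [Submodule.mem_colon] at ha ⊢
      intro f hf
      have h1 := hJ v hv _ (ha f hf)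
      rw [smul_eq_mul, Derivation.leibniz] at h1
      have := J.sub_mem h1 (ha _ (hTd v hv f hf))
      rwa [add_sub_cancel_left, smul_eq_mul, mul_comm] at this
    · exact Submodule.mem_colon.mpr hgT
  rw [mem_associatedPrimes_quotient_iff] at hP
  obtain ⟨hPp, f, hf⟩ := hP
  refine le_antisymm (fun g hg => ?_) hVP
  by_contra hgI
  -- If `P` were strictly larger than `I`, the element `f` with annihilator `P` would lie in `T`,
  -- hence in `J`.
  have hfT : f ∈ T := ⟨fun a ha => (hf a).mp (hVP ha), g, hgI, (hf g).mp hg⟩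
  have h1 : (1 : MvPolynomial (Fin l) K) ∈ J.colon (T : Set (MvPolynomial (Fin l) K)) :=
    htop ▸ Submodule.mem_top
  exact hPp.ne_top ((Ideal.eq_top_iff_one _).mpr
    ((hf 1).mpr (Submodule.mem_colon.mp h1 f hfT)))

end DirectionalDerivatives

/-! ### Flats, localizations and their associated primes. -/

namespace CentralArrangement

variable {K : Type*} [Field K] {l : ℕ} (A : CentralArrangement K l)

section Flats

variable {A} {Y : Submodule K (Fin l → K)}

lemma IsFlat.mem_iff (hY : A.IsFlat Y) (v : Fin l → K) :
    v ∈ Y ↔ ∀ f ∈ A.form '' {H | H ∈ A.hyperplanes ∧ Y ≤ H}, eval v f = 0 := by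
  obtain ⟨B, hB, rfl⟩ := hY
  simp only [Set.forall_mem_image, Set.mem_ofPred_eq]
  constructor
  · rintro hv H ⟨hH, hle⟩
    exact (A.mem_iff_eval_form H hH v).mp (hle hv)
  · intro h
    rw [Submodule.mem_finsetInf]
    exact fun H hH => (A.mem_iff_eval_form H (hB hH) v).mpr
      (h ⟨hB hH, Finset.inf_le (f := id) hH⟩)

lemma IsFlat.flatIdeal_eq [Infinite K] (hY : A.IsFlat Y) :
    A.flatIdeal Y = vanishingIdeal K (Y : Set (Fin l → K)) := by
  refine span_eq_vanishingIdeal ?_ hY.mem_iff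
  rintro _ ⟨H, ⟨hH, -⟩, rfl⟩
  exact A.form_isHomogeneous H hH

lemma form_mem_flatIdeal {H : Submodule K (Fin l → K)} (hH : H ∈ A.hyperplanes) (h : Y ≤ H) :
    A.form H ∈ A.flatIdeal Y :=
  Ideal.subset_span ⟨H, ⟨hH, h⟩, rfl⟩

lemma le_of_form_mem_vanishingIdeal {H : Submodule K (Fin l → K)} (hH : H ∈ A.hyperplanes)
    (h : A.form H ∈ vanishingIdeal K (Y : Set (Fin l → K))) : Y ≤ H := fun v hv =>
  (A.mem_iff_eval_form H hH v).mpr ((mem_vanishingIdeal_submodule Y _).mp h v hv)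

lemma IsFlat.le_of_vanishingIdeal_le {Z : Submodule K (Fin l → K)} (hY : A.IsFlat Y)
    (h : vanishingIdeal K (Y : Set (Fin l → K)) ≤ vanishingIdeal K (Z : Set (Fin l → K))) :
    Z ≤ Y := by
  intro v hv
  rw [hY.mem_iff]
  rintro _ ⟨H, ⟨hH, hle⟩, rfl⟩
  refine (mem_vanishingIdeal_submodule Z _).mp (h ?_) v hv
  rw [mem_vanishingIdeal_submodule]
  exact fun w hw => (A.mem_iff_eval_form H hH w).mp (hle hw)

lemma mem_hyperplanes_localization {H : Submodule K (Fin l → K)} :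
    H ∈ (A.localization Y).hyperplanes ↔ H ∈ A.hyperplanes ∧ Y ≤ H := by
  classical
  exact Finset.mem_filter

lemma IsFlat.localization (hY : A.IsFlat Y) : (A.localization Y).IsFlat Y := by
  obtain ⟨B, hB, rfl⟩ := hY
  exact ⟨B, fun H hH => mem_hyperplanes_localization.mpr ⟨hB hH, Finset.inf_le (f := id) hH⟩, rfl⟩

lemma le_of_isFlat_localization {Z : Submodule K (Fin l → K)}
    (hZ : (A.localization Y).IsFlat Z) : Y ≤ Z := by
  obtain ⟨B, hB, rfl⟩ := hZ
  exact Finset.le_inf fun H hH => (mem_hyperplanes_localization.mp (hB hH)).2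

end Flats

section Localization

variable (Y : Submodule K (Fin l → K))

open scoped Classical in
/-- The product of the forms of the hyperplanes that do not contain `Y`. -/
noncomputable def complementaryPolynomial : MvPolynomial (Fin l) K :=
  ∏ H ∈ A.hyperplanes with ¬ Y ≤ H, A.form H

lemma definingPolynomial_eq_mul : A.definingPolynomial =
    (A.localization Y).definingPolynomial * A.complementaryPolynomial Y := by
  classical
  exact (Finset.prod_filter_mul_prod_filter_not A.hyperplanes (fun H => Y ≤ H) A.form).symm

lemma definingPolynomial_mem_jacobianIdeal : A.definingPolynomial ∈ A.jacobianIdeal :=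
  Ideal.subset_span (Or.inl rfl)

lemma pderiv_definingPolynomial_mem_jacobianIdeal (i : Fin l) :
    pderiv i A.definingPolynomial ∈ A.jacobianIdeal :=
  Ideal.subset_span (Or.inr ⟨i, rfl⟩)

lemma jacobianIdeal_le_iff {I : Ideal (MvPolynomial (Fin l) K)} :
    A.jacobianIdeal ≤ I ↔
      A.definingPolynomial ∈ I ∧ ∀ i, pderiv i A.definingPolynomial ∈ I := by
  rw [jacobianIdeal, Ideal.span_le, Set.union_subset_iff, Set.singleton_subset_iff,
    Set.range_subset_iff]
  rfl

lemma jacobianIdeal_le_localization : A.jacobianIdeal ≤ (A.localization Y).jacobianIdeal := by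
  rw [jacobianIdeal_le_iff, A.definingPolynomial_eq_mul Y]
  refine ⟨Ideal.mul_mem_right _ _ (definingPolynomial_mem_jacobianIdeal _), fun i => ?_⟩
  rw [Derivation.leibniz]
  exact Ideal.add_mem _ (Ideal.mul_mem_right _ _ (definingPolynomial_mem_jacobianIdeal _))
    (Ideal.mul_mem_left _ _ (pderiv_definingPolynomial_mem_jacobianIdeal _ i))

/-- Writing `Q = Q_Y c`, one has `c² ∂Q_Y = c ∂Q - (∂c) Q`; this is why the square is needed. -/
lemma complementaryPolynomial_sq_mul_mem {x : MvPolynomial (Fin l) K}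
    (hx : x ∈ (A.localization Y).jacobianIdeal) :
    A.complementaryPolynomial Y ^ 2 * x ∈ A.jacobianIdeal := by
  have hle : (A.localization Y).jacobianIdeal ≤
      A.jacobianIdeal.colon {A.complementaryPolynomial Y ^ 2} := by
    rw [jacobianIdeal_le_iff]
    simp only [Submodule.mem_colon_singleton, smul_eq_mul]
    constructor
    · have := Ideal.mul_mem_left _ (A.complementaryPolynomial Y)
        A.definingPolynomial_mem_jacobianIdeal
      rw [A.definingPolynomial_eq_mul Y] at this
      convert this using 1
      ring
    · intro i
      have h1 := Ideal.mul_mem_left _ (A.complementaryPolynomial Y)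
        (A.pderiv_definingPolynomial_mem_jacobianIdeal i)
      have h2 := Ideal.mul_mem_left _ (pderiv i (A.complementaryPolynomial Y))
        A.definingPolynomial_mem_jacobianIdeal
      have h3 := Ideal.sub_mem _ h1 h2
      convert h3 using 1
      rw [A.definingPolynomial_eq_mul Y, Derivation.leibniz, smul_eq_mul, smul_eq_mul]
      ring
  rw [mul_comm]
  exact Submodule.mem_colon_singleton.mp (hle hx)

/-- Localizing the arrangement does not affect the associated primes avoiding the forms of the
removed hyperplanes. -/
lemma mem_associatedPrimes_localization_iff {P : Ideal (MvPolynomial (Fin l) K)} (hP : P.IsPrime)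
    (h : ∀ H ∈ A.hyperplanes, A.form H ∈ P → Y ≤ H) :
    P ∈ associatedPrimes _ (MvPolynomial (Fin l) K ⧸ A.jacobianIdeal) ↔
      P ∈ associatedPrimes _ (MvPolynomial (Fin l) K ⧸ (A.localization Y).jacobianIdeal) := by
  classical
  refine mem_associatedPrimes_quotient_iff_of_mul_mem (A.jacobianIdeal_le_localization Y)
    (s := A.complementaryPolynomial Y ^ 2) (fun hs => ?_)
    fun x hx => A.complementaryPolynomial_sq_mul_mem Y hx
  obtain ⟨H, hH, hHP⟩ := hP.prod_mem_iff.mp (hP.mem_of_pow_mem _ hs)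
  rw [Finset.mem_filter] at hH
  exact hH.2 (h H hH.1 hHP)

/-- A derivative along `Y` kills every form of `A_Y`, hence `Q_Y`, and it commutes with the partial
derivatives; so it kills all the generators. -/
lemma dirDeriv_mem_jacobianIdeal_localization {v : Fin l → K} (hv : v ∈ Y)
    {g : MvPolynomial (Fin l) K} (hg : g ∈ (A.localization Y).jacobianIdeal) :
    dirDeriv v g ∈ (A.localization Y).jacobianIdeal := by
  have hQ : dirDeriv v (A.localization Y).definingPolynomial = 0 := by
    refine Finset.prod_induction _ (fun p => dirDeriv v p = 0) (fun p q hp hq => ?_)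
      (Derivation.map_one_eq_zero _) fun H hH => ?_
    · rw [Derivation.leibniz, hp, hq, smul_zero, smul_zero, add_zero]
    · obtain ⟨h1, h2⟩ := mem_hyperplanes_localization.mp hH
      obtain ⟨c, -, hc⟩ := exists_form_eq h1
      have h3 := (A.mem_iff_eval_form H h1 v).mp (h2 hv)
      change dirDeriv v (A.form H) = 0
      rw [hc] at h3 ⊢
      rw [dirDeriv_linForm, h3, map_zero]
  rw [jacobianIdeal] at hg
  refine Submodule.span_induction (p := fun g _ => dirDeriv v g ∈
    (A.localization Y).jacobianIdeal) ?_ ?_ ?_ ?_ hg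
  · rintro _ (rfl | ⟨i, rfl⟩)
    · rw [hQ]
      exact Ideal.zero_mem _
    · rw [dirDeriv_pderiv, hQ, map_zero]
      exact Ideal.zero_mem _
  · rw [map_zero]
    exact Ideal.zero_mem _
  · intro x y _ _ hx hy
    rw [map_add]
    exact Ideal.add_mem _ hx hy
  · intro a x hx hx'
    rw [smul_eq_mul, Derivation.leibniz]
    exact Ideal.add_mem _ (Ideal.mul_mem_left _ _ hx') (Ideal.mul_mem_right _ _ hx)

end Localization

section Containment

variable {A} {Y : Submodule K (Fin l → K)}

lemma jacobianIdeal_le_of_mem_associatedPrimes {P : Ideal (MvPolynomial (Fin l) K)}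
    (hP : P ∈ associatedPrimes _ (MvPolynomial (Fin l) K ⧸ A.jacobianIdeal)) :
    A.jacobianIdeal ≤ P := by
  obtain ⟨-, f, hf⟩ := (mem_associatedPrimes_quotient_iff _ _).mp hP
  exact fun a ha => (hf a).mpr (Ideal.mul_mem_right _ _ ha)

/-- Two distinct hyperplanes contain `Y`, so `Q` has two factors in `I(Y)` and each Leibniz term
keeps one of them. -/
lemma IsFlat.jacobianIdeal_le_flatIdeal (hY : A.IsFlat Y)
    (h2 : 2 ≤ Module.finrank K ((Fin l → K) ⧸ Y)) : A.jacobianIdeal ≤ A.flatIdeal Y := by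
  classical
  have key : ∃ H ∈ A.hyperplanes, ∃ H' ∈ A.hyperplanes, Y ≤ H ∧ Y ≤ H' ∧ H ≠ H' := by
    by_contra! hcon
    obtain ⟨B, hB, hYB⟩ := id hY
    have hBY : ∀ H ∈ B, Y ≤ H := fun H hH => hYB ▸ Finset.inf_le (f := id) hH
    rcases B.eq_empty_or_nonempty with rfl | ⟨H, hH⟩
    · rw [Finset.inf_empty] at hYB
      have : Subsingleton ((Fin l → K) ⧸ Y) := Submodule.Quotient.subsingleton_iff.mpr hYB
      rw [Module.finrank_zero_of_subsingleton] at h2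
      omega
    · have hYH : Y = H := by
        refine le_antisymm (hBY H hH) ?_
        rw [hYB]
        exact Finset.le_inf fun H' hH' =>
          (hcon H (hB hH) H' (hB hH') (hBY H hH) (hBY H' hH')).le
      rw [hYH, A.codim_eq_one H (hB hH)] at h2
      omega
  obtain ⟨H, hH, H', hH', hle, hle', hne⟩ := key
  have hQ : A.definingPolynomial = A.form H * (A.form H' *
      ∏ H'' ∈ (A.hyperplanes.erase H).erase H', A.form H'') := by
    rw [Finset.mul_prod_erase _ _ (Finset.mem_erase.mpr ⟨hne.symm, hH'⟩),
      A.form_mul_prod_erase hH]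
  rw [jacobianIdeal_le_iff, hQ]
  refine ⟨Ideal.mul_mem_right _ _ (form_mem_flatIdeal hH hle), fun i => ?_⟩
  rw [Derivation.leibniz]
  exact Ideal.add_mem _ (Ideal.mul_mem_right _ _ (form_mem_flatIdeal hH hle))
    (Ideal.mul_mem_right _ _ (Ideal.mul_mem_right _ _ (form_mem_flatIdeal hH' hle')))

end Containment

section AssociatedPrimes

variable [CharZero K] {A}

/-- Every associated prime of the Jacobian algebra is the ideal of a flat. -/
lemma exists_isFlat_of_mem_associatedPrimes {P : Ideal (MvPolynomial (Fin l) K)}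
    (hP : P ∈ associatedPrimes _ (MvPolynomial (Fin l) K ⧸ A.jacobianIdeal)) :
    ∃ Y, A.IsFlat Y ∧ P = A.flatIdeal Y := by
  classical
  have hPp : P.IsPrime := IsAssociatedPrime.isPrime hP
  -- The flat is chosen so that the hyperplanes omitted from `A_Y` have forms outside `P`, while
  -- `I(Y) ≤ P`.
  let B := A.hyperplanes.filter fun H => A.form H ∈ P
  let Y := B.inf id
  have hY : A.IsFlat Y := ⟨B, Finset.filter_subset _ _, rfl⟩
  refine ⟨Y, hY, ?_⟩
  rw [hY.flatIdeal_eq]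
  refine eq_vanishingIdeal_of_mem_associatedPrimes Y
    (fun v hv g hg => A.dirDeriv_mem_jacobianIdeal_localization Y hv hg)
    ((A.mem_associatedPrimes_localization_iff Y hPp fun H hH hHP =>
      Finset.inf_le (f := id) (Finset.mem_filter.mpr ⟨hH, hHP⟩)).mp hP) ?_
  have hspan : Ideal.span (A.form '' B) = vanishingIdeal K (Y : Set (Fin l → K)) := by
    refine span_eq_vanishingIdeal ?_ fun v => ?_
    · rintro _ ⟨H, hH, rfl⟩
      exact A.form_isHomogeneous H (Finset.mem_filter.mp hH).1
    · rw [Submodule.mem_finsetInf, Set.forall_mem_image]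
      exact forall₂_congr fun H hH => A.mem_iff_eval_form H (Finset.mem_filter.mp hH).1 v
  rw [← hspan, Ideal.span_le]
  rintro _ ⟨H, hH, rfl⟩
  exact (Finset.mem_filter.mp hH).2

variable {Y : Submodule K (Fin l → K)}

lemma IsFlat.isPrime_flatIdeal (hY : A.IsFlat Y) : (A.flatIdeal Y).IsPrime := by
  rw [hY.flatIdeal_eq]
  infer_instance

lemma IsFlat.flatIdeal_mem_associatedPrimes_iff (hY : A.IsFlat Y) :
    A.flatIdeal Y ∈ associatedPrimes _ (MvPolynomial (Fin l) K ⧸ A.jacobianIdeal) ↔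
      A.flatIdeal Y ∈
        associatedPrimes _ (MvPolynomial (Fin l) K ⧸ (A.localization Y).jacobianIdeal) := by
  refine A.mem_associatedPrimes_localization_iff Y hY.isPrime_flatIdeal fun H hH h => ?_
  rw [hY.flatIdeal_eq] at h
  exact le_of_form_mem_vanishingIdeal hH h

/-- If the ideal of the flat `Y` is not associated, it kills no nonzero element of the Jacobian
algebra of `A_Y`. -/
lemma IsFlat.mem_jacobianIdeal_localization (hY : A.IsFlat Y)
    (h : A.flatIdeal Y ∉ associatedPrimes _ (MvPolynomial (Fin l) K ⧸ A.jacobianIdeal))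
    {e : MvPolynomial (Fin l) K}
    (he : ∀ f ∈ A.flatIdeal Y, f * e ∈ (A.localization Y).jacobianIdeal) :
    e ∈ (A.localization Y).jacobianIdeal := by
  by_contra hne
  obtain ⟨P, hP, hle⟩ := exists_le_mem_associatedPrimes_quotient hne he
  obtain ⟨Z, hZ, rfl⟩ := exists_isFlat_of_mem_associatedPrimes hP
  rw [hZ.flatIdeal_eq, hY.flatIdeal_eq] at hle
  -- Flats of `A_Y` contain `Y`, so no associated prime of `J(A_Y)` strictly contains `I(Y)`.
  have hZY : Z = Y := le_antisymm (hY.le_of_vanishingIdeal_le hle) (le_of_isFlat_localization hZ)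
  subst hZY
  rw [hY.flatIdeal_mem_associatedPrimes_iff, hY.flatIdeal_eq] at h
  rw [hZ.flatIdeal_eq] at hP
  exact h hP

/-- The Jacobian ideal is not contained in the ideal of a flat of rank less than two. -/
lemma IsFlat.two_le_of_jacobianIdeal_le (hY : A.IsFlat Y)
    (h : A.jacobianIdeal ≤ A.flatIdeal Y) : 2 ≤ Module.finrank K ((Fin l → K) ⧸ Y) := by
  classical
  have hQ : A.definingPolynomial ∈ A.flatIdeal Y := h A.definingPolynomial_mem_jacobianIdeal
  obtain ⟨H, hH, hHY⟩ := hY.isPrime_flatIdeal.prod_mem_iff.mp hQ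
  rw [hY.flatIdeal_eq] at hHY
  have hle := le_of_form_mem_vanishingIdeal hH hHY
  by_contra! hlt
  have hYH : Y = H := by
    apply Submodule.eq_of_le_of_finrank_le hle
    have h1 := Submodule.finrank_quotient_add_finrank H
    have h2 := Submodule.finrank_quotient_add_finrank Y
    rw [A.codim_eq_one _ hH] at h1
    omega
  subst hYH
  -- With `Y = H`, choose `i` with `∂ᵢα_H ≠ 0`: modulo `α_H`, `∂ᵢQ` is this constant times `Q/α_H`,
  -- which is not divisible by `α_H`.
  obtain ⟨c, hc0, hc⟩ := exists_form_eq hH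
  obtain ⟨i, hi⟩ := Function.ne_iff.mp hc0
  have hi' := h (A.pderiv_definingPolynomial_mem_jacobianIdeal i)
  rw [← A.form_mul_prod_erase hH, Derivation.leibniz, hY.flatIdeal_eq, ← span_form_eq hH,
    Ideal.mem_span_singleton, smul_eq_mul, smul_eq_mul, dvd_add_right (Dvd.intro _ rfl)] at hi'
  refine ((prime_form hH).dvd_or_dvd hi').elim
    (not_form_dvd_prod hH (Finset.erase_subset _ _) (Finset.notMem_erase _ _)) fun hd => ?_
  rw [hc, pderiv_linForm] at hd
  have hu : IsUnit (C (c i) : MvPolynomial (Fin l) K) :=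
    IsUnit.map C (isUnit_iff_ne_zero.mpr hi)
  exact (prime_form hH).not_isUnit (hc ▸ isUnit_of_dvd_unit hd hu)

/-- The ideals of the flats of rank two are associated primes. -/
lemma flatIdeal_mem_associatedPrimes_of_rank_two (hY : Y ∈ A.flatsOfRank 2) :
    A.flatIdeal Y ∈ associatedPrimes _ (MvPolynomial (Fin l) K ⧸ A.jacobianIdeal) := by
  obtain ⟨hY, h2⟩ := hY
  have hprime := hY.isPrime_flatIdeal
  obtain ⟨P, hP, hPle⟩ :=
    Ideal.exists_minimalPrimes_le (hY.jacobianIdeal_le_flatIdeal h2.ge)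
  have hP' : P ∈ associatedPrimes _ (MvPolynomial (Fin l) K ⧸ A.jacobianIdeal) := by
    apply Module.associatedPrimes.minimalPrimes_annihilator_subset_associatedPrimes
    rwa [Ideal.annihilator_quotient]
  obtain ⟨Z, hZ, rfl⟩ := exists_isFlat_of_mem_associatedPrimes hP'
  have hZ2 := hZ.two_le_of_jacobianIdeal_le (jacobianIdeal_le_of_mem_associatedPrimes hP')
  rw [hZ.flatIdeal_eq, hY.flatIdeal_eq] at hPle
  -- The minimal prime is `I(Z)` with `Y ≤ Z`, and `Z` already has rank at least 2.
  have hYZ : Y = Z := by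
    apply Submodule.eq_of_le_of_finrank_le (hZ.le_of_vanishingIdeal_le hPle)
    have h1 := Submodule.finrank_quotient_add_finrank Z
    have h2 := Submodule.finrank_quotient_add_finrank Y
    omega
  rwa [hYZ]

/-- The rank of a flat whose ideal is associated is at most the projective dimension. -/
lemma IsFlat.finrank_le_of_mem_associatedPrimes (hY : A.IsFlat Y)
    (h : A.flatIdeal Y ∈ associatedPrimes _ (MvPolynomial (Fin l) K ⧸ A.jacobianIdeal)) {n : ℕ}
    (hn : HasProjectiveDimensionLT (ModuleCat.of (MvPolynomial (Fin l) K)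
        (MvPolynomial (Fin l) K ⧸ A.jacobianIdeal)) (n + 1)) :
    Module.finrank K ((Fin l → K) ⧸ Y) ≤ n := by
  by_contra! hlt
  obtain ⟨rs, hlen, hreg, hhom, hmem⟩ := exists_isWeaklyRegular_linear _ Y rfl
  obtain ⟨hp, f, hf⟩ := (mem_associatedPrimes_quotient_iff _ _).mp h
  -- The element with annihilator `I(Y)` is killed by a regular sequence longer than the projective
  -- dimension.
  have h0 := eq_zero_of_hasProjectiveDimensionLT hreg hn (by omega)
    (Ideal.Quotient.mk A.jacobianIdeal f) (fun r hr => by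
      refine Ideal.Quotient.eq_zero_iff_mem.mpr ((hf r).mp ?_)
      rw [hY.flatIdeal_eq, mem_vanishingIdeal_submodule]
      exact fun v hv => (hmem v).mp hv r hr)
  rw [Ideal.Quotient.eq_zero_iff_mem] at h0
  exact hp.ne_top ((Ideal.eq_top_iff_one _).mpr ((hf 1).mpr (by rwa [one_mul])))

end AssociatedPrimes

end CentralArrangement

/-! ### Saito's criterion and its local form. -/

namespace CentralArrangement

variable {K : Type*} [Field K] {l : ℕ} (A : CentralArrangement K l)

/-- The matrix of coefficients of a tuple of polynomial vector fields. -/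
noncomputable def coeffMatrix {K : Type*} [Field K] {l : ℕ} {ι : Type*}
    (δ : ι → Derivation K (MvPolynomial (Fin l) K) (MvPolynomial (Fin l) K)) :
    Matrix ι (Fin l) (MvPolynomial (Fin l) K) :=
  Matrix.of fun i j => δ i (X j)

variable {A}

lemma derivation_linForm (δ : Derivation K (MvPolynomial (Fin l) K) (MvPolynomial (Fin l) K))
    (c : Fin l → K) : δ (linForm c) = ∑ j, δ (X j) * C (c j) := by
  rw [derivation_apply_eq_sum]
  simp

variable {δ : Fin l → Derivation K (MvPolynomial (Fin l) K) (MvPolynomial (Fin l) K)}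

/-- Modulo `α_H` the matrix kills the nonzero constant coefficient vector of `α_H`; multiplying by
the adjugate shows that `α_H` divides the determinant. -/
lemma definingPolynomial_dvd_det [Infinite K] (hδ : ∀ i, δ i ∈ A.logDerivations) :
    A.definingPolynomial ∣ (coeffMatrix δ).det := by
  refine definingPolynomial_dvd fun H hH => ?_
  obtain ⟨c, hc0, hc⟩ := exists_form_eq hH
  obtain ⟨j, hj⟩ := Function.ne_iff.mp hc0
  choose w hw using fun i => Ideal.mem_span_singleton.mp (hδ i H hH)
  have h1 : (coeffMatrix δ).mulVec (fun j => C (c j)) = A.form H • w := by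
    funext i
    rw [Pi.smul_apply, smul_eq_mul, ← hw i, hc, derivation_linForm]
    rfl
  have h2 : (coeffMatrix δ).det • (fun j => (C (c j) : MvPolynomial (Fin l) K)) =
      A.form H • (coeffMatrix δ).adjugate.mulVec w := by
    rw [← Matrix.mulVec_smul, ← h1, Matrix.mulVec_mulVec, Matrix.adjugate_mul,
      Matrix.smul_mulVec, Matrix.one_mulVec]
  have h3 := congrFun h2 j
  simp only [Pi.smul_apply, smul_eq_mul] at h3
  have hu : IsUnit (C (c j) : MvPolynomial (Fin l) K) :=
    IsUnit.map C (isUnit_iff_ne_zero.mpr hj)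
  exact hu.dvd_mul_right.mp ⟨_, h3⟩

/-- Saito's criterion. -/
lemma isFree_of_det_eq [Infinite K] (hδ : ∀ i, δ i ∈ A.logDerivations) {c : K} (hc : c ≠ 0)
    (hdet : (coeffMatrix δ).det = A.definingPolynomial * C c) : A.IsFree := by
  have hdet0 : (coeffMatrix δ).det ≠ 0 := by
    rw [hdet]
    exact mul_ne_zero A.definingPolynomial_ne_zero (by simpa using hc)
  let b : Fin l → A.logDerivations := fun i => ⟨δ i, hδ i⟩
  have hli : LinearIndependent (MvPolynomial (Fin l) K) b := by
    have h := Matrix.linearIndependent_rows_of_det_ne_zero hdet0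
    exact LinearIndependent.of_comp
      (derivationCoeffs.toLinearMap ∘ₗ A.logDerivations.subtype) h
  have hsp : ⊤ ≤ Submodule.span (MvPolynomial (Fin l) K) (Set.range b) := by
    rintro ⟨η, hη⟩ -
    -- Cramer's rule: the determinants with one row replaced by `η` are multiples of `Q`, and the
    -- quotients, divided by `c`, are the coefficients of `η`.
    have hdvd : ∀ i, A.definingPolynomial ∣
        ((coeffMatrix δ).updateRow i (derivationCoeffs η)).det := by
      intro i
      have : (coeffMatrix δ).updateRow i (derivationCoeffs η) =
          coeffMatrix (Function.update δ i η) := by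
        ext1 j k
        rcases eq_or_ne j i with rfl | h
        · simp [coeffMatrix]
        · simp [coeffMatrix, h]
      rw [this]
      refine definingPolynomial_dvd_det fun j => ?_
      rcases eq_or_ne j i with rfl | h
      · simpa using hη
      · simpa [h] using hδ j
    choose w hw using hdvd
    have h1 := Matrix.mulVec_cramer (coeffMatrix δ).transpose (derivationCoeffs η)
    rw [Matrix.det_transpose, hdet] at h1
    have hval : ∀ j, η (X j) = ∑ i, (C c⁻¹ * w i) * δ i (X j) := by
      intro j
      apply mul_left_cancel₀ A.definingPolynomial_ne_zero
      have h2 := congrFun h1 j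
      simp only [Matrix.mulVec, dotProduct, Matrix.cramer_transpose_apply, hw, Pi.smul_apply,
        smul_eq_mul, derivationCoeffs_apply, Matrix.transpose_apply] at h2
      have hcc : (C c * C c⁻¹ : MvPolynomial (Fin l) K) = 1 := by
        rw [← C_mul, mul_inv_cancel₀ hc, C_1]
      calc A.definingPolynomial * η (X j)
          = C c⁻¹ * (A.definingPolynomial * C c * η (X j)) := by
            linear_combination (-A.definingPolynomial * η (X j)) * hcc
        _ = _ := by
            rw [← h2, Finset.mul_sum, Finset.mul_sum]
            refine Finset.sum_congr rfl fun i _ => ?_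
            rw [show coeffMatrix δ i j = δ i (X j) from rfl]
            ring
    rw [Submodule.mem_span_range_iff_exists_fun]
    refine ⟨fun i => C c⁻¹ * w i, Subtype.ext (derivationCoeffs.injective ?_)⟩
    funext j
    have h3 : (derivationCoeffs.toLinearMap ∘ₗ A.logDerivations.subtype)
        (∑ i, (C c⁻¹ * w i) • b i) j = ∑ i, (C c⁻¹ * w i) * δ i (X j) := by
      rw [map_sum, Finset.sum_apply]
      simp only [map_smul]
      rfl
    exact h3.trans (hval j).symm
  exact Module.Free.of_basis (Module.Basis.mk hli hsp)

/-- The homogeneous components of a vector field. -/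
noncomputable def derivationComponent {K : Type*} [Field K] {l : ℕ} (d : ℕ)
    (η : Derivation K (MvPolynomial (Fin l) K) (MvPolynomial (Fin l) K)) :
    Derivation K (MvPolynomial (Fin l) K) (MvPolynomial (Fin l) K) :=
  mkDerivation K fun i => homogeneousComponent d (η (X i))

/-- Since `α_H` has constant partial derivatives, applying the component to it gives the degree `d`
component of `η α_H`, and the ideal `(α_H)` is homogeneous. -/
lemma derivationComponent_mem {η : Derivation K (MvPolynomial (Fin l) K) (MvPolynomial (Fin l) K)}
    (hη : η ∈ A.logDerivations) (d : ℕ) : derivationComponent d η ∈ A.logDerivations := by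
  intro H hH
  obtain ⟨c, -, hc⟩ := exists_form_eq hH
  let _ : GradedAlgebra (homogeneousSubmodule (Fin l) K) := MvPolynomial.gradedAlgebra
  have hhom : (Ideal.span {A.form H}).IsHomogeneous (homogeneousSubmodule (Fin l) K) :=
    Ideal.homogeneous_span _ _ fun x hx => ⟨1, by
      rw [Set.mem_singleton_iff.mp hx]
      exact A.form_isHomogeneous H hH⟩
  have h1 := homogeneousComponent_mem_of_mem hhom (hη H hH) d
  convert h1 using 1
  rw [hc, derivation_linForm, derivation_linForm, map_sum]
  refine Finset.sum_congr rfl fun j _ => ?_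
  rw [derivationComponent, mkDerivation_X, mul_comm, mul_comm _ (C (c j)),
    homogeneousComponent_C_mul]

lemma isHomogeneous_det_coeffMatrix {d : Fin l → ℕ}
    (h : ∀ i j, (δ i (X j)).IsHomogeneous (d i)) :
    (coeffMatrix δ).det.IsHomogeneous (∑ i, d i) := by
  rw [← Matrix.det_transpose, Matrix.det_apply]
  refine IsHomogeneous.sum _ _ _ fun σ _ => ?_
  have h1 : (∏ i, δ i (X (σ i))).IsHomogeneous (∑ i, d i) :=
    IsHomogeneous.prod _ _ _ fun i _ => h i (σ i)
  rw [← mem_homogeneousSubmodule] at h1 ⊢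
  rw [Units.smul_def]
  exact zsmul_mem h1 _

/-- A homogeneous multiple `q * h` of a homogeneous polynomial `q ≠ 0`, where `h` has a nonzero
constant term, is a constant multiple. -/
lemma eq_C_of_isHomogeneous_mul {q h : MvPolynomial (Fin l) K} {m n : ℕ} (hq0 : q ≠ 0)
    (hq : q.IsHomogeneous n) (hqh : (q * h).IsHomogeneous m) (hh : constantCoeff h ≠ 0) :
    h = C (constantCoeff h) := by
  -- The part of `q * h` in degree `n` is `q` times the constant term of `h`. It is nonzero, so it
  -- is all of `q * h`.
  have h1 : homogeneousComponent n (q * h) = q * C (constantCoeff h) := by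
    conv_lhs => rw [← sum_homogeneousComponent h, Finset.mul_sum, map_sum]
    rw [Finset.sum_eq_single 0]
    · rw [homogeneousComponent_zero, homogeneousComponent_eq_self]
      · rfl
      · simpa using hq.mul (isHomogeneous_C _ _)
    · intro k _ hk
      rw [homogeneousComponent_of_mem (hq.mul (homogeneousComponent_isHomogeneous k h)),
        if_neg (by omega)]
    · simp
  have hne : q * C (constantCoeff h) ≠ 0 := mul_ne_zero hq0 (by simpa using hh)
  rw [homogeneousComponent_of_mem hqh] at h1
  split_ifs at h1 with hmn
  · exact mul_left_cancel₀ hq0 h1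
  · exact absurd h1.symm hne

/-- Expanding the determinant over homogeneous components of the rows, some term has a quotient by
`Q` with nonzero constant term; by homogeneity that quotient is a constant, and Saito's criterion
applies. -/
lemma isFree_of_det_eq_mul_of_constantCoeff_ne_zero [Infinite K]
    (hδ : ∀ i, δ i ∈ A.logDerivations) {g : MvPolynomial (Fin l) K}
    (hdet : (coeffMatrix δ).det = A.definingPolynomial * g) (hg : constantCoeff g ≠ 0) :
    A.IsFree := by
  obtain ⟨N, hN⟩ : ∃ N, ∀ i j, (δ i (X j)).totalDegree < N := by
    refine ⟨(∑ i, ∑ j, (δ i (X j)).totalDegree) + 1, fun i j => Nat.lt_succ_of_le ?_⟩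
    exact (Finset.single_le_sum (f := fun j => (δ i (X j)).totalDegree) (fun _ _ => Nat.zero_le _)
      (Finset.mem_univ j)).trans (Finset.single_le_sum
      (f := fun i => ∑ j, (δ i (X j)).totalDegree) (fun _ _ => Nat.zero_le _) (Finset.mem_univ i))
  have hsum : ∀ p : MvPolynomial (Fin l) K, p.totalDegree < N →
      p = ∑ d : Fin N, homogeneousComponent d p := by
    intro p hp
    rw [Fin.sum_univ_eq_sum_range fun d => homogeneousComponent d p]
    conv_lhs => rw [← sum_homogeneousComponent p]
    refine Finset.sum_subset (Finset.range_mono hp) fun d _ hd => ?_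
    rw [Finset.mem_range, not_lt] at hd
    exact homogeneousComponent_eq_zero _ _ hd
  have hexp : (coeffMatrix δ).det =
      ∑ r : Fin l → Fin N, (coeffMatrix fun i => derivationComponent (r i) (δ i)).det := by
    have h1 : coeffMatrix δ =
        fun i => ∑ d : Fin N, fun j => homogeneousComponent d (δ i (X j)) := by
      funext i j
      rw [Finset.sum_apply]
      exact hsum _ (hN i j)
    have h2 := (Matrix.detRowAlternating (R := MvPolynomial (Fin l) K)
      (n := Fin l)).toMultilinearMap.map_sum
      (α := fun _ => Fin N) fun i d j => homogeneousComponent d (δ i (X j))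
    rw [h1]
    refine h2.trans (Finset.sum_congr rfl fun r _ => ?_)
    have h3 : (coeffMatrix fun i => derivationComponent (r i) (δ i)) =
        fun i j => homogeneousComponent (r i) (δ i (X j)) := by
      funext i j
      exact mkDerivation_X K _ j
    rw [h3]
    rfl
  have hlog : ∀ r : Fin l → Fin N, ∀ i, derivationComponent (r i) (δ i) ∈ A.logDerivations :=
    fun r i => derivationComponent_mem (hδ i) _
  choose w hw using fun r => definingPolynomial_dvd_det (hlog r)
  have hg' : g = ∑ r, w r := by
    apply mul_left_cancel₀ A.definingPolynomial_ne_zero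
    rw [← hdet, hexp, Finset.mul_sum]
    exact Finset.sum_congr rfl fun r _ => hw r
  obtain ⟨r, hr⟩ : ∃ r, constantCoeff (w r) ≠ 0 := by
    by_contra! hcon
    apply hg
    rw [hg', map_sum]
    exact Finset.sum_eq_zero fun r _ => hcon r
  refine isFree_of_det_eq (hlog r) hr ?_
  have hhom := isHomogeneous_det_coeffMatrix (δ := fun i => derivationComponent (r i) (δ i))
    (d := fun i => r i) fun i j => by
      rw [derivationComponent, mkDerivation_X]
      exact homogeneousComponent_isHomogeneous _ _
  rw [hw r] at hhom ⊢
  congr 1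
  exact eq_C_of_isHomogeneous_mul A.definingPolynomial_ne_zero
    A.isHomogeneous_definingPolynomial hhom hr

/-- The translation `x ↦ x + p` on polynomials. -/
noncomputable def translation {K : Type*} [Field K] {l : ℕ} (p : Fin l → K) :
    MvPolynomial (Fin l) K →ₐ[K] MvPolynomial (Fin l) K :=
  aeval fun i => X i + C (p i)

lemma translation_linForm (p c : Fin l → K) :
    translation p (linForm c) = linForm c + C (eval p (linForm c)) := by
  simp [translation, linForm, mul_add, Finset.sum_add_distrib, algebraMap_eq]

lemma constantCoeff_translation (p : Fin l → K) (g : MvPolynomial (Fin l) K) :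
    constantCoeff (translation p g) = eval p g := by
  induction g using MvPolynomial.induction_on with
  | C a => simp [translation, algebraMap_eq]
  | add p q hp hq => simp only [map_add, hp, hq]
  | mul_X q i hq => simp [translation] at hq ⊢; simp [hq]

lemma translation_form {p : Fin l → K} {H : Submodule K (Fin l → K)} (hH : H ∈ A.hyperplanes)
    (hp : p ∈ H) : translation p (A.form H) = A.form H := by
  obtain ⟨c, -, hc⟩ := exists_form_eq hH
  have h := (A.mem_iff_eval_form H hH p).mp hp
  rw [hc] at h ⊢
  rw [translation_linForm, h, map_zero, add_zero]

/-- An arrangement is free if it is free near some point in the intersection of its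
hyperplanes. -/
lemma isFree_of_det_eq_mul_of_eval_ne_zero [Infinite K]
    (hδ : ∀ i, δ i ∈ A.logDerivations) {g : MvPolynomial (Fin l) K}
    (hdet : (coeffMatrix δ).det = A.definingPolynomial * g) {p : Fin l → K}
    (hp : ∀ H ∈ A.hyperplanes, p ∈ H) (hg : eval p g ≠ 0) : A.IsFree := by
  -- Translation by `p` fixes every form, hence `Q` and the logarithmic condition, and turns `g(p)`
  -- into a constant term.
  let δ' : Fin l → Derivation K (MvPolynomial (Fin l) K) (MvPolynomial (Fin l) K) :=
    fun i => mkDerivation K fun j => translation p (δ i (X j))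
  have hδ' : ∀ i, δ' i ∈ A.logDerivations := by
    intro i H hH
    obtain ⟨w, hw⟩ := Ideal.mem_span_singleton.mp (hδ i H hH)
    obtain ⟨c, -, hc⟩ := exists_form_eq hH
    refine Ideal.mem_span_singleton.mpr ⟨translation p w, ?_⟩
    have h1 : δ' i (A.form H) = translation p (δ i (A.form H)) := by
      rw [hc, derivation_linForm, derivation_linForm, map_sum]
      refine Finset.sum_congr rfl fun j _ => ?_
      rw [map_mul, mkDerivation_X]
      congr 1
      exact (algHom_C _ _).symm
    rw [h1, hw, map_mul, translation_form hH (hp H hH)]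
  refine isFree_of_det_eq_mul_of_constantCoeff_ne_zero (g := translation p g) hδ' ?_
    (by rwa [constantCoeff_translation])
  have h2 : coeffMatrix δ' = (translation p).mapMatrix (coeffMatrix δ) := by
    ext1 i j
    exact mkDerivation_X K _ j
  rw [h2, ← AlgHom.map_det, hdet, map_mul]
  congr 1
  rw [definingPolynomial, map_prod]
  exact Finset.prod_congr rfl fun H hH => translation_form hH (hp H hH)

end CentralArrangement

/-! ### Generators at a prime. -/

section LocalGenerators

universe u

/-- If the finite torsion-free module `M ⊆ Rˡ` is free at `P`, then `l` elements generate it at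
`P`. -/
lemma exists_generators_of_free_localizedModule {R : Type u} [CommRing R] [IsDomain R]
    {M : Type u} [AddCommGroup M] [Module R M] [Module.Finite R M] {l : ℕ}
    (f : M →ₗ[R] (Fin l → R)) (hf : Function.Injective f) (P : Ideal R) [P.IsPrime]
    (hfree : Module.Free (Localization.AtPrime P) (LocalizedModule P.primeCompl M)) :
    ∃ δ : Fin l → M, ∀ m, ∃ s ∉ P, s • m ∈ Submodule.span R (Set.range δ) := by
  let F := LocalizedModule.mkLinearMap P.primeCompl M
  let b := Module.Free.chooseBasis (Localization.AtPrime P) (LocalizedModule P.primeCompl M)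
  let ι := Module.Free.ChooseBasisIndex (Localization.AtPrime P)
    (LocalizedModule P.primeCompl M)
  have hb : ∀ i : ι, ∃ (m : M) (s : P.primeCompl), F m = s • b i := by
    intro i
    obtain ⟨⟨m, s⟩, hms⟩ := IsLocalizedModule.surj P.primeCompl F (b i)
    exact ⟨m, s, hms.symm⟩
  choose m s hms using hb
  have hms' : ∀ i, F (m i) = (algebraMap R (Localization.AtPrime P) (s i)) • b i := by
    intro i
    rw [hms, algebraMap_smul]
    rfl
  have hli : LinearIndependent R m := by
    rw [Fintype.linearIndependent_iff]
    intro r hr i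
    have h1 := congrArg F hr
    rw [map_sum, map_zero] at h1
    have h2 : ∑ j, (algebraMap R (Localization.AtPrime P) (r j * s j)) • b j = 0 := by
      rw [← h1]
      refine Finset.sum_congr rfl fun j _ => ?_
      rw [map_smul, hms', map_mul, mul_smul, algebraMap_smul (Localization.AtPrime P) (r j)]
    have h3 := Fintype.linearIndependent_iff.mp b.linearIndependent _ h2 i
    have h4 : r i * s i = 0 := by
      apply IsLocalization.injective (Localization.AtPrime P) P.primeCompl_le_nonZeroDivisors
      rw [h3, map_zero]
    refine (mul_eq_zero.mp h4).resolve_right fun h0 => (s i).2 ?_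
    rw [h0]
    exact P.zero_mem
  -- Basis vectors with cleared denominators are independent in `Rˡ`; if there are fewer than `l`,
  -- the family is padded by zeros.
  have hcard : Fintype.card ι ≤ l := by
    have := (hli.map' f (LinearMap.ker_eq_bot.mpr hf)).fintype_card_le_finrank
    simpa using this
  obtain ⟨e⟩ : Nonempty (ι ↪ Fin l) :=
    Function.Embedding.nonempty_of_card_le (by simpa using hcard)
  refine ⟨Function.extend e m 0, fun x => ?_⟩
  have hspan : Submodule.localized' (Localization.AtPrime P) P.primeCompl F
      (Submodule.span R (Set.range m)) = ⊤ := by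
    rw [Submodule.localized'_span, eq_top_iff, ← b.span_eq, Submodule.span_le]
    rintro _ ⟨i, rfl⟩
    have hu : IsUnit (algebraMap R (Localization.AtPrime P) (s i)) :=
      IsLocalization.map_units _ (s i)
    rw [SetLike.mem_coe, ← Submodule.smul_mem_iff_of_isUnit _ hu, ← hms']
    exact Submodule.subset_span ⟨m i, ⟨i, rfl⟩, rfl⟩
  have hx : F x ∈ Submodule.localized' (Localization.AtPrime P) P.primeCompl F
      (Submodule.span R (Set.range m)) := hspan ▸ Submodule.mem_top
  obtain ⟨n, hn, t, ht⟩ := (Submodule.mem_localized' _ _ _ _ _).mp hx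
  rw [IsLocalizedModule.mk'_eq_iff] at ht
  have ht' : F n = F ((t : R) • x) := by
    rw [ht, map_smul]
    rfl
  obtain ⟨c, hc⟩ := (IsLocalizedModule.eq_iff_exists P.primeCompl F).mp ht'
  refine ⟨c * t, fun h => ?_, ?_⟩
  · exact (Ideal.IsPrime.mem_or_mem ‹_› h).elim c.2 t.2
  · have h1 : ((c : R) * t) • x = (c : R) • n := by
      rw [mul_smul]
      exact hc.symm
    rw [h1]
    refine Submodule.smul_mem _ _ (Submodule.span_mono ?_ hn)
    rintro _ ⟨i, rfl⟩
    exact ⟨e i, e.injective.extend_apply m 0 i⟩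

open RingTheory.Sequence in
/-- If generators of the prime `P` form a regular sequence on `M ⊆ Rˡ`, then `l` elements generate
`M` at `P`. -/
lemma exists_generators_of_isWeaklyRegular {R : Type u} [CommRing R] [IsDomain R]
    [IsNoetherianRing R] {M : Type u} [AddCommGroup M] [Module R M] [Module.Finite R M] {l : ℕ}
    (f : M →ₗ[R] (Fin l → R)) (hf : Function.Injective f) {P : Ideal R} (hP : P.IsPrime)
    {rs : List R} (hrs : Ideal.ofList rs = P) (hM : IsWeaklyRegular M rs) :
    ∃ δ : Fin l → M, ∀ m, ∃ s ∉ P, s • m ∈ Submodule.span R (Set.range δ) := by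
  have hMP := hM.of_isLocalizedModule (Localization.AtPrime P) P.primeCompl
    (LocalizedModule.mkLinearMap P.primeCompl M)
  exact exists_generators_of_free_localizedModule f hf P
    (free_of_isWeaklyRegular_of_ofList_eq_maximalIdeal _ (Localization.AtPrime P)
      (LocalizedModule P.primeCompl M) (rs.map (algebraMap _ _)) rfl
      (by rw [← Ideal.map_ofList, hrs, Localization.AtPrime.map_eq_maximalIdeal]) hMP)

end LocalGenerators

/-! ### Rank three flats and the conclusion. -/

namespace CentralArrangement

variable {K : Type*} [Field K] {l : ℕ} {A : CentralArrangement K l}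

open scoped Classical in
/-- Logarithmic vector fields whose determinant is `Q` times a power of `Q / α_H`. -/
lemma exists_det_eq_mul_pow {H : Submodule K (Fin l → K)} (hH : H ∈ A.hyperplanes) :
    ∃ (η : Fin l → Derivation K (MvPolynomial (Fin l) K) (MvPolynomial (Fin l) K)) (k : ℕ),
      (∀ i, η i ∈ A.logDerivations) ∧ (coeffMatrix η).det =
        A.definingPolynomial * (∏ H' ∈ A.hyperplanes.erase H, A.form H') ^ k := by
  obtain ⟨c, hc0, hc⟩ := exists_form_eq hH
  obtain ⟨i₀, hi₀⟩ := Function.ne_iff.mp hc0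
  rw [Pi.zero_apply] at hi₀
  set q := ∏ H' ∈ A.hyperplanes.erase H, A.form H'
  -- For `j ≠ i₀`, `∂ⱼ - (cⱼ/c_{i₀}) ∂_{i₀}` kills `α_H`, so the factor `Q/α_H` suffices to make it
  -- logarithmic; `∂_{i₀}` itself is multiplied by `Q`.
  let u : Fin l → MvPolynomial (Fin l) K := fun j => if j = i₀ then 0 else -C (c j / c i₀)
  let d : Fin l → MvPolynomial (Fin l) K := fun j => if j = i₀ then A.definingPolynomial else q
  let η : Fin l → Derivation K (MvPolynomial (Fin l) K) (MvPolynomial (Fin l) K) :=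
    fun j => d j • (pderiv j + u j • pderiv i₀)
  refine ⟨η, (Finset.univ.erase i₀).card, fun j => ?_, ?_⟩
  · intro H' hH'
    rw [Ideal.mem_span_singleton]
    by_cases hj : j = i₀
    · have h1 : A.form H' ∣ d j := by
        simp only [d, if_pos hj]
        exact Finset.dvd_prod_of_mem A.form hH'
      exact Dvd.dvd.mul_right h1 _
    · by_cases hHH : H' = H
      · subst hHH
        have h2 : η j (A.form H') = 0 := by
          simp only [η, u, if_neg hj, hc, Derivation.smul_apply, Derivation.add_apply,
            pderiv_linForm, smul_eq_mul, neg_mul, ← C_mul, div_mul_cancel₀ _ hi₀]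
          rw [add_neg_cancel, mul_zero]
        rw [h2]
        exact dvd_zero _
      · have h1 : A.form H' ∣ d j := by
          simp only [d, if_neg hj]
          exact Finset.dvd_prod_of_mem A.form (Finset.mem_erase.mpr ⟨hHH, hH'⟩)
        exact Dvd.dvd.mul_right h1 _
  -- A diagonal matrix times a rank one perturbation of the identity, whose determinant is `1 + u i₀
  -- = 1`.
  · have hM : coeffMatrix η = Matrix.diagonal d *
        (1 + Matrix.replicateCol Unit u * Matrix.replicateRow Unit
          (Pi.single i₀ 1 : Fin l → MvPolynomial (Fin l) K)) := by
      ext1 i j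
      rw [Matrix.diagonal_mul, Matrix.add_apply, Matrix.mul_apply, Matrix.one_apply]
      simp only [coeffMatrix, η, Matrix.of_apply, Derivation.smul_apply, Derivation.add_apply,
        pderiv_X, Pi.single_apply, smul_eq_mul, Matrix.replicateCol_apply,
        Matrix.replicateRow_apply, Finset.univ_unique, Finset.sum_const, Finset.card_singleton,
        one_smul, eq_comm]
    rw [hM, Matrix.det_mul, Matrix.det_diagonal, Matrix.det_one_add_replicateCol_mul_replicateRow,
      ← Finset.mul_prod_erase _ _ (Finset.mem_univ i₀)]
    have h3 : ∏ j ∈ Finset.univ.erase i₀, d j = q ^ (Finset.univ.erase i₀).card := by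
      rw [← Finset.prod_const]
      refine Finset.prod_congr rfl fun j hj => ?_
      simp only [d, if_neg (Finset.ne_of_mem_erase hj)]
    rw [h3]
    simp [u, d]

variable {δ : Fin l → Derivation K (MvPolynomial (Fin l) K) (MvPolynomial (Fin l) K)}

/-- The determinant of vector fields generating `D(A)` at the prime `P` is `Q` up to a unit
at `P`. -/
lemma notMem_of_generates [Infinite K] (hA : A.hyperplanes.Nonempty)
    {P : Ideal (MvPolynomial (Fin l) K)} (hP : P.IsPrime)
    (hgen : ∀ η ∈ A.logDerivations,
      ∃ s ∉ P, s • η ∈ Submodule.span (MvPolynomial (Fin l) K) (Set.range δ))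
    {g : MvPolynomial (Fin l) K}
    (hdet : (coeffMatrix δ).det = A.definingPolynomial * g) : g ∉ P := by
  classical
  -- Expressing the fields of `exists_det_eq_mul_pow` through `δ` up to denominators `s` and
  -- comparing determinants bounds `g`.
  have key : ∀ H ∈ A.hyperplanes, ∃ s ∉ P, ∃ k : ℕ,
      g ∣ s * (∏ H' ∈ A.hyperplanes.erase H, A.form H') ^ k := by
    intro H hH
    obtain ⟨η, k, hη, hηdet⟩ := exists_det_eq_mul_pow hH
    choose s hs hsη using fun i => hgen (η i) (hη i)
    simp only [Submodule.mem_span_range_iff_exists_fun] at hsη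
    choose c hc using hsη
    refine ⟨∏ i, s i, fun h => ?_, k, ?_⟩
    · obtain ⟨i, -, hi⟩ := hP.prod_mem_iff.mp h
      exact hs i hi
    · have hM : Matrix.diagonal s * coeffMatrix η = Matrix.of c * coeffMatrix δ := by
        ext1 i j
        rw [Matrix.diagonal_mul, Matrix.mul_apply]
        have h1 := congrFun (congrArg derivationCoeffs (hc i)) j
        rw [map_sum, Finset.sum_apply] at h1
        exact h1.symm
      have h2 := congrArg Matrix.det hM
      rw [Matrix.det_mul, Matrix.det_mul, Matrix.det_diagonal, hηdet, hdet] at h2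
      refine ⟨(Matrix.of c).det, mul_left_cancel₀ A.definingPolynomial_ne_zero ?_⟩
      linear_combination h2
  intro hg
  obtain ⟨H, hH⟩ := hA
  have hg0 : g ≠ 0 := by
    rintro rfl
    obtain ⟨s, hs, k, h⟩ := key H hH
    rw [zero_dvd_iff, mul_eq_zero] at h
    rcases h with rfl | h
    · exact hs P.zero_mem
    · exact pow_ne_zero k (Finset.prod_ne_zero_iff.mpr
        fun H' hH' => form_ne_zero (Finset.mem_of_mem_erase hH')) h
  obtain ⟨π, hπ, hπP, hπg⟩ : ∃ π, Irreducible π ∧ π ∈ P ∧ π ∣ g := by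
    have h1 : (UniqueFactorizationMonoid.factors g).prod ∈ P :=
      (UniqueFactorizationMonoid.factors_prod hg0).symm.dvd.elim fun u hu =>
        hu ▸ P.mul_mem_right u hg
    obtain ⟨π, hπ, hπP⟩ := (hP.multiset_prod_mem_iff_exists_mem _).mp h1
    exact ⟨π, UniqueFactorizationMonoid.irreducible_of_factor π hπ, hπP,
      UniqueFactorizationMonoid.dvd_of_mem_factors hπ⟩
  have hdvd : ∀ H ∈ A.hyperplanes, π ∣ ∏ H' ∈ A.hyperplanes.erase H, A.form H' := by
    intro H hH
    obtain ⟨s, hs, k, h⟩ := key H hH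
    refine hπ.prime.dvd_of_dvd_pow ((hπ.prime.dvd_or_dvd (hπg.trans h)).resolve_left fun hd => ?_)
    exact hs (P.mem_of_dvd hd hπP)
  -- An irreducible factor `π ∈ P` of `g` divides `Q/α_H` for every `H`. It is then associated to
  -- some `α_H'`, yet divides `Q/α_H'`, contradicting squarefreeness.
  obtain ⟨H', hH', hd⟩ := hπ.prime.dvd_finsetProd_iff _ |>.mp (hdvd H hH)
  have hH'A := Finset.mem_of_mem_erase hH'
  exact not_form_dvd_prod hH'A (Finset.erase_subset _ _) (Finset.notMem_erase _ _)
    ((hπ.dvd_symm (prime_form hH'A).irreducible hd).trans (hdvd H' hH'A))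

open RingTheory.Sequence in
/-- The ideal of a rank three flat with nonfree localization is an associated prime. -/
lemma flatIdeal_mem_associatedPrimes_of_rank_three [CharZero K] {Y : Submodule K (Fin l → K)}
    (hY : Y ∈ A.flatsOfRank 3) (hfree : ¬ (A.localization Y).IsFree) :
    A.flatIdeal Y ∈ associatedPrimes _ (MvPolynomial (Fin l) K ⧸ A.jacobianIdeal) := by
  obtain ⟨hY, h3⟩ := hY
  by_contra hass
  refine hfree ?_
  have hp : (A.flatIdeal Y).IsPrime := hY.isPrime_flatIdeal
  obtain ⟨rs, hlen, hreg, hhom, hmem⟩ := exists_isWeaklyRegular_linear 3 Y h3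
  have hofList : Ideal.ofList rs = A.flatIdeal Y := by
    rw [hY.flatIdeal_eq]
    exact span_eq_vanishingIdeal hhom hmem
  -- As `I(Y)` is not associated, no nonzero class modulo `J(A_Y)` is killed by the three linear
  -- forms.
  have hker : IsWeaklyRegular (LinearMap.ker (A.localization Y).jacobianMap) rs := by
    obtain ⟨x, y, z, rfl⟩ := List.length_eq_three.mp hlen
    refine isWeaklyRegular_ker _ hreg fun e hx hy hz => ?_
    rw [range_jacobianMap] at hx hy hz ⊢
    refine hY.mem_jacobianIdeal_localization hass fun f hf => ?_
    have hle : A.flatIdeal Y ≤ (A.localization Y).jacobianIdeal.colon {e} := by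
      rw [← hofList, Ideal.ofList, Ideal.span_le]
      intro r hr
      simp only [List.mem_cons, List.not_mem_nil, or_false, Set.mem_ofPred_eq] at hr
      rcases hr with rfl | rfl | rfl <;> exact Submodule.mem_colon_singleton.mpr ‹_›
    exact Submodule.mem_colon_singleton.mp (hle hf)
  have hD : IsWeaklyRegular (A.localization Y).logDerivations rs :=
    ((A.localization Y).logDerivationsEquivKer.isWeaklyRegular_congr rs).mp hker
  have hfin : Module.Finite (MvPolynomial (Fin l) K) (A.localization Y).logDerivations :=
    Module.Finite.equiv (A.localization Y).logDerivationsEquivKer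
  obtain ⟨δ, hδ⟩ := exists_generators_of_isWeaklyRegular (R := MvPolynomial (Fin l) K)
    (M := (A.localization Y).logDerivations)
    (derivationCoeffs.toLinearMap ∘ₗ (A.localization Y).logDerivations.subtype)
    (derivationCoeffs.injective.comp Subtype.val_injective) hp hofList hD
  obtain ⟨g, hg⟩ := definingPolynomial_dvd_det (A := A.localization Y) fun i => (δ i).2
  have hne : (A.localization Y).hyperplanes.Nonempty := by
    obtain ⟨B, hB, hYB⟩ := hY.localization
    rcases B.eq_empty_or_nonempty with rfl | ⟨H, hH⟩
    · rw [Finset.inf_empty] at hYB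
      have : Subsingleton ((Fin l → K) ⧸ Y) := Submodule.Quotient.subsingleton_iff.mpr hYB
      rw [Module.finrank_zero_of_subsingleton] at h3
      omega
    · exact ⟨H, hB hH⟩
  have hgP : g ∉ A.flatIdeal Y := by
    refine notMem_of_generates hne hp (fun η hη => ?_) hg
    obtain ⟨s, hs, h⟩ := hδ ⟨η, hη⟩
    refine ⟨s, hs, ?_⟩
    have h1 := Submodule.mem_map_of_mem (f := (A.localization Y).logDerivations.subtype) h
    rw [Submodule.map_span, ← Set.range_comp] at h1
    exact h1
  rw [hY.flatIdeal_eq, mem_vanishingIdeal_submodule] at hgP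
  push Not at hgP
  -- `g` does not vanish identically on `Y`, and every hyperplane of `A_Y` contains the chosen
  -- point.
  obtain ⟨p, hpY, hpg⟩ := hgP
  exact isFree_of_det_eq_mul_of_eval_ne_zero (fun i => (δ i).2) hg
    (fun H hH => (mem_hyperplanes_localization.mp hH).2 hpY) hpg

/-- The associated primes of a Jacobian algebra of projective dimension at most three. -/
lemma associatedPrimes_quotient_jacobianIdeal [CharZero K]
    (h : HasProjectiveDimensionLT (ModuleCat.of (MvPolynomial (Fin l) K)
        (MvPolynomial (Fin l) K ⧸ A.jacobianIdeal)) 4) :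
    associatedPrimes (MvPolynomial (Fin l) K) (MvPolynomial (Fin l) K ⧸ A.jacobianIdeal) =
        {P | ∃ X ∈ A.flatsOfRank 2, P = A.flatIdeal X} ∪
        {P | ∃ X ∈ A.flatsOfRank 3, ¬ (A.localization X).IsFree ∧ P = A.flatIdeal X} := by
  apply Set.Subset.antisymm
  · intro P hP
    obtain ⟨Y, hY, rfl⟩ := exists_isFlat_of_mem_associatedPrimes hP
    have h2 := hY.two_le_of_jacobianIdeal_le (jacobianIdeal_le_of_mem_associatedPrimes hP)
    have h3 := hY.finrank_le_of_mem_associatedPrimes hP (n := 3) h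
    rcases (show Module.finrank K ((Fin l → K) ⧸ Y) = 2 ∨
      Module.finrank K ((Fin l → K) ⧸ Y) = 3 by omega) with hr | hr
    · exact Or.inl ⟨Y, ⟨hY, hr⟩, rfl⟩
    · refine Or.inr ⟨Y, ⟨hY, hr⟩, fun hfree => ?_, rfl⟩
      -- The rank bound is applied to `A_Y`, where freeness limits the rank to 2.
      rw [hY.flatIdeal_mem_associatedPrimes_iff, hY.flatIdeal_eq,
        ← hY.localization.flatIdeal_eq] at hP
      have := hY.localization.finrank_le_of_mem_associatedPrimes hP (n := 2)
        hfree.hasProjectiveDimensionLT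
      omega
  · rintro P (⟨Y, hY, rfl⟩ | ⟨Y, hY, hfree, rfl⟩)
    · exact flatIdeal_mem_associatedPrimes_of_rank_two hY
    · exact flatIdeal_mem_associatedPrimes_of_rank_three hY hfree

end CentralArrangement

theorem theorem4p6 {K : Type*} [Field K] [CharZero K] {l : ℕ} (A : CentralArrangement K l) :
    (projectiveDimension (ModuleCat.of (MvPolynomial (Fin l) K)
        (MvPolynomial (Fin l) K ⧸ A.jacobianIdeal)) = 3 →
      associatedPrimes (MvPolynomial (Fin l) K) (MvPolynomial (Fin l) K ⧸ A.jacobianIdeal) =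
        {P | ∃ X ∈ A.flatsOfRank 2, P = A.flatIdeal X} ∪
        {P | ∃ X ∈ A.flatsOfRank 3, ¬ (A.localization X).IsFree ∧ P = A.flatIdeal X}) ∧
    (A.IsPlusOneGenerated →
      projectiveDimension (ModuleCat.of (MvPolynomial (Fin l) K)
        (MvPolynomial (Fin l) K ⧸ A.jacobianIdeal)) = 3 ∧
      associatedPrimes (MvPolynomial (Fin l) K) (MvPolynomial (Fin l) K ⧸ A.jacobianIdeal) =
        {P | ∃ X ∈ A.flatsOfRank 2, P = A.flatIdeal X} ∪
        {P | ∃ X ∈ A.flatsOfRank 3, ¬ (A.localization X).IsFree ∧ P = A.flatIdeal X}) := by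
  have key : projectiveDimension (ModuleCat.of (MvPolynomial (Fin l) K)
        (MvPolynomial (Fin l) K ⧸ A.jacobianIdeal)) = 3 →
      associatedPrimes (MvPolynomial (Fin l) K) (MvPolynomial (Fin l) K ⧸ A.jacobianIdeal) =
        {P | ∃ X ∈ A.flatsOfRank 2, P = A.flatIdeal X} ∪
        {P | ∃ X ∈ A.flatsOfRank 3, ¬ (A.localization X).IsFree ∧ P = A.flatIdeal X} :=
    fun h => CentralArrangement.associatedPrimes_quotient_jacobianIdeal
      ((projectiveDimension_le_iff _ 3).mp h.le)
  exact ⟨key, fun h => ⟨h.projectiveDimension_eq, key h.projectiveDimension_eq⟩⟩
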